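/- Let $\mathcal{L}\subset\mathbb{P}^2_{\mathbb{C}}$ be a real arrangement of $d\ge 4$ lines, that is, a finite set of $d$ distinct lines in the complex projective plane each of which is the zero locus of a nonzero linear form with real coefficients. For $r\ge 2$ let $t_r$ be the number of points of $\mathbb{P}^2_{\mathbb{C}}$ lying on exactly $r$ of the lines, and put $f_0=\sum_{r\ge 2}t_r$ and $f_1=\sum_{r\ge 2}r\,t_r$. Suppose that $t_d=t_{d-1}=0$. Then $3-2d+f_1-f_0>0$, so the characteristic number $$\gamma(\mathcal{L})=\frac{9-5d+3f_1-4f_0}{3-2d+f_1-f_0}$$ is well defined, and $$\gamma(\mathcal{L})\le\frac{5}{2}.$$ Moreover, $\gamma(\mathcal{L})=\frac52$ if and only if $\mathcal{L}$ is simplicial, i.e. every connected component of $\mathbb{P}^2_{\mathbb{R}}\setminus\bigcup_{\ell\in\mathcal{L}}\ell$ is an open two-dimensional simplex. Here an open two-dimensional simplex in $\mathbb{P}^2_{\mathbb{R}}$ is a set of the form $\{[c_0v_0+c_1v_1+c_2v_2] : c_0,c_1,c_2>0\}$ for some basis $v_0,v_1,v_2$ of $\mathbb{R}^3$. -/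

import Mathlib

open scoped LinearAlgebra.Projectivization

/-- The complex projective plane. -/
abbrev CP2 : Type := ℙ ℂ (Fin 3 → ℂ)

/-- The real projective plane. -/
abbrev RP2 : Type := ℙ ℝ (Fin 3 → ℝ)

/-- The quotient topology that the real projective plane gets from `ℝ³ \ {0}`. -/
noncomputable instance RP2.instTopologicalSpace : TopologicalSpace RP2 :=
  TopologicalSpace.coinduced
    (Projectivization.mk' ℝ : {v : Fin 3 → ℝ // v ≠ 0} → RP2) inferInstance

/-- The coordinatewise inclusion of `ℝ³` into `ℂ³`. -/
def complexify : (Fin 3 → ℝ) →ₛₗ[Complex.ofRealHom] (Fin 3 → ℂ) where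
  toFun v i := (v i : ℂ)
  map_add' v w := by ext i; simp
  map_smul' c v := by ext i; simp

theorem complexify_injective : Function.Injective complexify := by
  intro v w h
  ext i
  exact Complex.ofReal_injective (congrFun h i)

/-- The canonical embedding of the real projective plane into the complex one. -/
noncomputable def RP2.toCP2 : RP2 → CP2 := Projectivization.map complexify complexify_injective

/-- The zero locus in the complex projective plane of the linear form with coefficients `a`. -/
def zeroLocus (a : Fin 3 → ℂ) : Set CP2 :=
  {p | ∀ v ∈ p.submodule, ∑ i, a i * v i = 0}

/-- A line of the complex projective plane that is defined over the real numbers: the zero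
locus of a nonzero linear form with real coefficients. -/
def IsRealLine (l : Set CP2) : Prop :=
  ∃ a : Fin 3 → ℝ, a ≠ 0 ∧ l = zeroLocus (complexify a)

/-- A real line arrangement: a finite set of (pairwise distinct) lines in the complex projective
plane, each of them defined over the real numbers. -/
structure RealLineArrangement where
  lines : Finset (Set CP2)
  isRealLine : ∀ l ∈ lines, IsRealLine l

namespace RealLineArrangement

variable (L : RealLineArrangement)

/-- The number `d` of lines. -/
def d : ℕ := L.lines.card

/-- The multiplicity of a point: the number of lines of the arrangement through it. -/
noncomputable def mult (p : CP2) : ℕ := {l | l ∈ L.lines ∧ p ∈ l}.ncard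

/-- `t_r`: the number of points at which exactly `r` lines of the arrangement meet
(used for `r ≥ 2`, where this set of points is finite). -/
noncomputable def t (r : ℕ) : ℕ := {p : CP2 | L.mult p = r}.ncard

/-- `f₀ = ∑_{r ≥ 2} t_r`; there are no points of multiplicity larger than `d`. -/
noncomputable def f₀ : ℕ := ∑ r ∈ Finset.Icc 2 L.d, L.t r

/-- `f₁ = ∑_{r ≥ 2} r t_r`. -/
noncomputable def f₁ : ℕ := ∑ r ∈ Finset.Icc 2 L.d, r * L.t r

/-- The first log Chern number `9 - 5d + 3f₁ - 4f₀`. -/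
noncomputable def logChernOneSq : ℤ := 9 - 5 * L.d + 3 * L.f₁ - 4 * L.f₀

/-- The second log Chern number `3 - 2d + f₁ - f₀`. -/
noncomputable def logChernTwo : ℤ := 3 - 2 * L.d + L.f₁ - L.f₀

/-- The characteristic number `γ(L)`, the quotient of the two log Chern numbers. -/
noncomputable def charNumber : ℝ := (L.logChernOneSq : ℝ) / (L.logChernTwo : ℝ)

/-- The complement of the lines of the arrangement in the real projective plane. -/
def realComplement : Set RP2 := {x | ∀ l ∈ L.lines, x.toCP2 ∉ l}

end RealLineArrangement

/-- Open two-dimensional simplices (open triangles) in the real projective plane: for some basis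
`v₀, v₁, v₂` of `ℝ³`, the set of all points `[c₀ v₀ + c₁ v₁ + c₂ v₂]` with `c₀, c₁, c₂ > 0`, that
is, one of the triangles with vertices `[v₀]`, `[v₁]`, `[v₂]`, without its boundary. -/
def IsOpenTriangle (s : Set RP2) : Prop :=
  ∃ v : Fin 3 → (Fin 3 → ℝ), LinearIndependent ℝ v ∧
    s = {x | ∃ c : Fin 3 → ℝ, (∀ i, 0 < c i) ∧ ∑ i, c i • v i ∈ x.submodule}

/-- The arrangement is simplicial: every connected component of the complement of its lines in
the real projective plane is an open two-dimensional simplex. -/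
def RealLineArrangement.IsSimplicial (L : RealLineArrangement) : Prop :=
  ∀ x ∈ L.realComplement, IsOpenTriangle (connectedComponentIn L.realComplement x)

/-! Writing c₁², c₂ for the two log Chern numbers, 2c₁² - 5c₂ = 3 + f₁ - 3f₀. Once c₂ > 0, the claim
is therefore Melchior's inequality 3 + f₁ ≤ 3f₀, with equality exactly for simplicial arrangements.
Multiple points of a real arrangement are real, so everything can be counted with linear forms on
ℝ³.

Melchior's inequality comes from counting pairs (cone, vertex), without edges. The planes cut ℝ³
into 2(1 + f₁ - f₀) open cones (`card_signRegions_top`, by adding one plane at a time). A point of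
multiplicity r is a vertex of 4r cones, so there are 4f₁ pairs (`sum_card_coneVertices`). Each cone
is generated by its vertices and has nonempty interior, so it has at least three of them. Hence 6(1
+ f₁ - f₀) ≤ 4f₁, which is the inequality, and equality means that every cone has exactly three
vertices. Such cones are the simplicial ones (`exists_simplicial_of_card_eq_three`,
`card_coneVertices_le_three`), and their images are the components of the real complement.

For c₂ > 0 the lines are again added one at a time, starting from the pencil through one multiple
point (`two_mul_le_sum_multIn_sub_one`). -/

/-! ### Regions cut out by linear forms: deletion and restriction -/

section SignRegions

variable {ι V : Type*} [AddCommGroup V] [Module ℝ V]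

/-- A small displacement of `v` does not change the signs of finitely many linear forms that do
not vanish at `v`. -/
theorem exists_pos_forall_pos_add_smul (f : ι → V →ₗ[ℝ] ℝ) (A : Finset ι) (v w : V) :
    ∃ ε : ℝ, 0 < ε ∧ ∀ i ∈ A, (0 < f i v → 0 < f i (v + ε • w)) ∧
      (f i v < 0 → f i (v + ε • w) < 0) := by
  have h : ∀ i ∈ A, ∀ᶠ ε : ℝ in nhdsWithin 0 (Set.Ioi 0), (0 < f i v → 0 < f i (v + ε • w)) ∧
      (f i v < 0 → f i (v + ε • w) < 0) := by
    intro i _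
    have ht : Filter.Tendsto (fun ε : ℝ => f i (v + ε • w)) (nhdsWithin 0 (Set.Ioi 0))
        (nhds (f i v)) := by
      have : Continuous (fun ε : ℝ => f i v + ε * f i w) := by fun_prop
      have h0 := (this.tendsto 0).mono_left (nhdsWithin_le_nhds (s := Set.Ioi 0))
      simpa using h0
    refine Filter.Eventually.and ?_ ?_
    · by_cases h : 0 < f i v
      · filter_upwards [ht.eventually (lt_mem_nhds h)] with ε hε _ using hε
      · exact Filter.Eventually.of_forall fun _ h' => absurd h' h
    · by_cases h : f i v < 0
      · filter_upwards [ht.eventually (gt_mem_nhds h)] with ε hε _ using hε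
      · exact Filter.Eventually.of_forall fun _ h' => absurd h' h
  obtain ⟨ε, hε, hε'⟩ := (((Filter.eventually_all_finset A).2 h).and
    (self_mem_nhdsWithin : Set.Ioi (0 : ℝ) ∈ _)).exists
  exact ⟨ε, hε', hε⟩

open Classical in
/-- The regions cut out in the subspace `W` by the forms `f i`, `i ∈ A`; a region is given by the
set of those `i` for which `f i` is positive on it. -/
noncomputable def signRegions (f : ι → V →ₗ[ℝ] ℝ) (W : Submodule ℝ V) (A : Finset ι) :
    Finset (Finset ι) :=
  A.powerset.filter fun S => ∃ v ∈ W, (∀ i ∈ S, 0 < f i v) ∧ ∀ i ∈ A, i ∉ S → f i v < 0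

variable {f : ι → V →ₗ[ℝ] ℝ} {W : Submodule ℝ V} {A S : Finset ι}

theorem mem_signRegions : S ∈ signRegions f W A ↔
    S ⊆ A ∧ ∃ v ∈ W, (∀ i ∈ S, 0 < f i v) ∧ ∀ i ∈ A, i ∉ S → f i v < 0 := by
  simp [signRegions]

theorem signRegions_empty : signRegions f W ∅ = {∅} := by
  ext S
  simp only [mem_signRegions, Finset.subset_empty, Finset.mem_singleton]
  refine ⟨fun h => h.1, ?_⟩
  rintro rfl
  exact ⟨rfl, 0, W.zero_mem, by simp⟩

/-- Deletion–restriction. With X and Y the old regions that meet `f i > 0` and `f i < 0`, X ∪ Y is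
all old regions, X ∩ Y those cut by the new hyperplane, and the new regions are a disjoint union of
copies of X and Y. -/
theorem card_signRegions_insert [DecidableEq ι] {i : ι} (hi : i ∉ A) {w : V} (hw : w ∈ W)
    (hiw : f i w ≠ 0) :
    (signRegions f W (insert i A)).card =
      (signRegions f W A).card + (signRegions f (W ⊓ LinearMap.ker (f i)) A).card := by
  classical
  let X := (signRegions f W A).filter fun S =>
    ∃ v ∈ W, (∀ j ∈ S, 0 < f j v) ∧ (∀ j ∈ A, j ∉ S → f j v < 0) ∧ 0 < f i v
  let Y := (signRegions f W A).filter fun S =>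
    ∃ v ∈ W, (∀ j ∈ S, 0 < f j v) ∧ (∀ j ∈ A, j ∉ S → f j v < 0) ∧ f i v < 0
  have hXmem : ∀ {S}, S ∈ X ↔ S ⊆ A ∧
      ∃ v ∈ W, (∀ j ∈ S, 0 < f j v) ∧ (∀ j ∈ A, j ∉ S → f j v < 0) ∧ 0 < f i v := by
    intro S
    simp only [X, Finset.mem_filter, mem_signRegions]
    exact ⟨fun h => ⟨h.1.1, h.2⟩, fun ⟨h, v, a, b, c, d⟩ => ⟨⟨h, v, a, b, c⟩, v, a, b, c, d⟩⟩
  have hYmem : ∀ {S}, S ∈ Y ↔ S ⊆ A ∧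
      ∃ v ∈ W, (∀ j ∈ S, 0 < f j v) ∧ (∀ j ∈ A, j ∉ S → f j v < 0) ∧ f i v < 0 := by
    intro S
    simp only [Y, Finset.mem_filter, mem_signRegions]
    exact ⟨fun h => ⟨h.1.1, h.2⟩, fun ⟨h, v, a, b, c, d⟩ => ⟨⟨h, v, a, b, c⟩, v, a, b, c, d⟩⟩
  have hXi : ∀ {S}, S ∈ X → i ∉ S := fun hS h => hi ((hXmem.1 hS).1 h)
  have hunion : X ∪ Y = signRegions f W A := by
    apply Finset.Subset.antisymm
    · exact Finset.union_subset (Finset.filter_subset _ _) (Finset.filter_subset _ _)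
    · intro S hS
      obtain ⟨hSA, v, hvW, hp, hn⟩ := mem_signRegions.1 hS
      rw [Finset.mem_union, hXmem, hYmem]
      rcases lt_trichotomy (f i v) 0 with h | h | h
      · exact Or.inr ⟨hSA, v, hvW, hp, hn, h⟩
      · obtain ⟨ε, hε, hε'⟩ := exists_pos_forall_pos_add_smul f A v w
        have hmem : v + ε • w ∈ W := W.add_mem hvW (W.smul_mem _ hw)
        have hval : f i (v + ε • w) = ε * f i w := by simp [h]
        have h1 : ∀ j ∈ S, 0 < f j (v + ε • w) := fun j hj => (hε' j (hSA hj)).1 (hp j hj)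
        have h2 : ∀ j ∈ A, j ∉ S → f j (v + ε • w) < 0 :=
          fun j hj hjS => (hε' j hj).2 (hn j hj hjS)
        rcases lt_or_gt_of_ne hiw with h3 | h3
        · exact Or.inr ⟨hSA, _, hmem, h1, h2, hval ▸ mul_neg_of_pos_of_neg hε h3⟩
        · exact Or.inl ⟨hSA, _, hmem, h1, h2, hval ▸ mul_pos hε h3⟩
      · exact Or.inl ⟨hSA, v, hvW, hp, hn, h⟩
  have hinter : X ∩ Y = signRegions f (W ⊓ LinearMap.ker (f i)) A := by
    ext S
    rw [Finset.mem_inter, hXmem, hYmem, mem_signRegions]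
    constructor
    · rintro ⟨⟨hSA, v, hvW, hvp, hvn, hv⟩, -, u, huW, hup, hun, hu⟩
      -- Up to scaling, the point where the segment from `v` to `u` crosses the hyperplane.
      refine ⟨hSA, (-f i u) • v + f i v • u, ⟨W.add_mem (W.smul_mem _ hvW) (W.smul_mem _ huW),
        ?_⟩, fun j hj => ?_, fun j hj hjS => ?_⟩
      · simp only [SetLike.mem_coe, LinearMap.mem_ker, map_add, map_smul, smul_eq_mul]
        ring
      · have h1 := mul_pos (neg_pos.2 hu) (hvp j hj)
        have h2 := mul_pos hv (hup j hj)
        simp only [map_add, map_smul, smul_eq_mul]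
        linarith
      · have h1 := mul_neg_of_pos_of_neg (neg_pos.2 hu) (hvn j hj hjS)
        have h2 := mul_neg_of_pos_of_neg hv (hun j hj hjS)
        simp only [map_add, map_smul, smul_eq_mul]
        linarith
    · rintro ⟨hSA, v, ⟨hvW, hv⟩, hp, hn⟩
      have hv0 : f i v = 0 := hv
      have key : ∀ u ∈ W, ∃ z ∈ W, (∀ j ∈ S, 0 < f j z) ∧ (∀ j ∈ A, j ∉ S → f j z < 0) ∧
          ∃ ε : ℝ, 0 < ε ∧ f i z = ε * f i u := by
        intro u hu
        obtain ⟨ε, hε, hε'⟩ := exists_pos_forall_pos_add_smul f A v u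
        exact ⟨v + ε • u, W.add_mem hvW (W.smul_mem _ hu),
          fun j hj => (hε' j (hSA hj)).1 (hp j hj), fun j hj hjS => (hε' j hj).2 (hn j hj hjS),
          ε, hε, by simp [hv0]⟩
      -- The direction `f i w • w` has `f i`-value `(f i w)²`, so its sign is known without a case
      -- split.
      obtain ⟨z, hz, hzp, hzn, ε, hε, he⟩ := key (f i w • w) (W.smul_mem _ hw)
      obtain ⟨y, hy, hyp, hyn, δ, hδ, hd⟩ := key (-(f i w • w)) (W.neg_mem (W.smul_mem _ hw))
      have hsq : 0 < f i w * f i w := mul_self_pos.2 hiw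
      refine ⟨⟨hSA, z, hz, hzp, hzn, ?_⟩, hSA, y, hy, hyp, hyn, ?_⟩
      · rw [he]; simpa using mul_pos hε hsq
      · rw [hd]; simpa using mul_pos hδ hsq
  have hR : signRegions f W (insert i A) = X.image (insert i) ∪ Y := by
    ext S
    rw [Finset.mem_union, Finset.mem_image, mem_signRegions, hYmem]
    constructor
    · rintro ⟨hSA, v, hvW, hp, hn⟩
      by_cases hiS : i ∈ S
      · refine Or.inl ⟨S.erase i, hXmem.2 ⟨?_, v, hvW, ?_, ?_, hp i hiS⟩,
          Finset.insert_erase hiS⟩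
        · exact Finset.subset_insert_iff.1 hSA
        · exact fun j hj => hp j (Finset.mem_of_mem_erase hj)
        · intro j hj hjS
          refine hn j (Finset.mem_insert_of_mem hj) fun h => hjS ?_
          exact Finset.mem_erase.2 ⟨fun h' => hi (h' ▸ hj), h⟩
      · refine Or.inr ⟨?_, v, hvW, hp, ?_, ?_⟩
        · exact (Finset.subset_insert_iff_of_notMem hiS).1 hSA
        · exact fun j hj => hn j (Finset.mem_insert_of_mem hj)
        · exact hn i (Finset.mem_insert_self _ _) hiS
    · rintro (⟨T, hT, rfl⟩ | ⟨hSA, v, hvW, hp, hn, hv⟩)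
      · obtain ⟨hTA, v, hvW, hp, hn, hv⟩ := hXmem.1 hT
        refine ⟨Finset.insert_subset_insert _ hTA, v, hvW, ?_, ?_⟩
        · intro j hj
          rcases Finset.mem_insert.1 hj with rfl | hj
          exacts [hv, hp j hj]
        · intro j hj hjT
          rw [Finset.mem_insert, not_or] at hjT
          exact hn j ((Finset.mem_insert.1 hj).resolve_left hjT.1) hjT.2
      · refine ⟨hSA.trans (Finset.subset_insert _ _), v, hvW, hp, ?_⟩
        intro j hj hjS
        rcases Finset.mem_insert.1 hj with rfl | hj
        exacts [hv, hn j hj hjS]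
  have hdisj : Disjoint (X.image (insert i)) Y := by
    rw [Finset.disjoint_left]
    rintro S hS hSY
    obtain ⟨T, -, rfl⟩ := Finset.mem_image.1 hS
    exact hi ((hYmem.1 hSY).1 (Finset.mem_insert_self _ _))
  have hinj : Set.InjOn (insert i) (X : Set (Finset ι)) := by
    intro S hS T hT h
    have := congrArg (fun U => U.erase i) h
    simpa [Finset.erase_insert (hXi hS), Finset.erase_insert (hXi hT)] using this
  rw [hR, Finset.card_union_of_disjoint hdisj, Finset.card_image_of_injOn hinj, ← hunion, ← hinter,
    Finset.card_union_add_card_inter]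

theorem signRegions_span_singleton_of_eq_zero {w : V} {j : ι} (hj : j ∈ A) (h : f j w = 0) :
    signRegions f (Submodule.span ℝ {w}) A = ∅ := by
  ext S
  simp only [mem_signRegions, Finset.notMem_empty, iff_false]
  rintro ⟨-, v, hv, hp, hn⟩
  obtain ⟨c, rfl⟩ := Submodule.mem_span_singleton.1 hv
  by_cases hjS : j ∈ S
  · simpa [h] using hp j hjS
  · simpa [h] using hn j hj hjS

/-- The regions are the two open half-lines. Nonemptiness of `A` excludes the origin and gives the
two half-lines different sign sets. -/
theorem card_signRegions_span_singleton {w : V} (hA : A.Nonempty) (h : ∀ j ∈ A, f j w ≠ 0) :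
    (signRegions f (Submodule.span ℝ {w}) A).card = 2 := by
  classical
  have : signRegions f (Submodule.span ℝ {w}) A =
      {A.filter fun j => 0 < f j w, A.filter fun j => f j w < 0} := by
    ext S
    simp only [mem_signRegions, Finset.mem_insert, Finset.mem_singleton]
    constructor
    · rintro ⟨hSA, v, hv, hp, hn⟩
      obtain ⟨c, rfl⟩ := Submodule.mem_span_singleton.1 hv
      simp only [map_smul, smul_eq_mul] at hp hn
      obtain ⟨k, hk⟩ := hA
      have hc : c ≠ 0 := by
        rintro rfl
        by_cases hkS : k ∈ S
        · simpa using hp k hkS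
        · simpa using hn k hk hkS
      rcases lt_or_gt_of_ne hc with hc | hc
      · right
        ext j
        rw [Finset.mem_filter]
        refine ⟨fun hj => ⟨hSA hj, neg_of_mul_pos_right (hp j hj) hc.le⟩, fun hj => ?_⟩
        · by_contra hjS
          nlinarith [hn j hj.1 hjS, mul_pos_of_neg_of_neg hc hj.2]
      · left
        ext j
        rw [Finset.mem_filter]
        refine ⟨fun hj => ⟨hSA hj, (mul_pos_iff_of_pos_left hc).1 (hp j hj)⟩, fun hj => ?_⟩
        by_contra hjS
        nlinarith [hn j hj.1 hjS, mul_pos hc hj.2]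
    · rintro (rfl | rfl)
      · refine ⟨Finset.filter_subset _ _, w, Submodule.mem_span_singleton_self w,
          fun j hj => (Finset.mem_filter.1 hj).2, fun j hj hjS => ?_⟩
        simp only [Finset.mem_filter, hj, true_and, not_lt] at hjS
        exact lt_of_le_of_ne hjS (h j hj)
      · refine ⟨Finset.filter_subset _ _, -w,
          Submodule.neg_mem _ (Submodule.mem_span_singleton_self w),
          fun j hj => by simpa using (Finset.mem_filter.1 hj).2, fun j hj hjS => ?_⟩
        simp only [Finset.mem_filter, hj, true_and, not_lt] at hjS
        simpa using lt_of_le_of_ne hjS (h j hj).symm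
  rw [this, Finset.card_pair]
  obtain ⟨k, hk⟩ := hA
  intro heq
  have := Finset.ext_iff.1 heq k
  simp only [Finset.mem_filter, hk, true_and] at this
  rcases lt_or_gt_of_ne (h k hk) with h' | h'
  · exact (this.2 h').not_gt h'
  · exact (this.1 h').not_gt h'

end SignRegions

/-! ### Counting cones and their incidences with multiple points -/

section Arrangement

variable {ι V : Type*} [AddCommGroup V] [Module ℝ V]

/-- The zero sets of the linear forms `f i` are pairwise distinct lines of the projective plane
of `V`. -/
structure IsLineFamily (f : ι → V →ₗ[ℝ] ℝ) : Prop where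
  exists_ne : ∀ i, ∃ w, f i w ≠ 0
  exists_ne_of_ne : ∀ i j, i ≠ j → ∃ w, f i w = 0 ∧ f j w ≠ 0
  inter : ∀ i j, i ≠ j →
    ∃ w, w ≠ 0 ∧ LinearMap.ker (f i) ⊓ LinearMap.ker (f j) = Submodule.span ℝ {w}

/-- `P` is the set of points lying on at least two of the lines. -/
def IsMultiplePoints (f : ι → V →ₗ[ℝ] ℝ) (P : Finset (ℙ ℝ V)) : Prop :=
  ∀ p, p ∈ P ↔ ∃ i j, i ≠ j ∧ f i p.rep = 0 ∧ f j p.rep = 0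

variable {f : ι → V →ₗ[ℝ] ℝ} {P : Finset (ℙ ℝ V)} {A : Finset ι}

theorem IsLineFamily.exists_point (hf : IsLineFamily f) {i j : ι} (hij : i ≠ j) :
    ∃ p : ℙ ℝ V, LinearMap.ker (f i) ⊓ LinearMap.ker (f j) = Submodule.span ℝ {p.rep} ∧
      f i p.rep = 0 ∧ f j p.rep = 0 ∧ ∀ q : ℙ ℝ V, f i q.rep = 0 → f j q.rep = 0 → q = p := by
  obtain ⟨w, hw, h⟩ := hf.inter i j hij
  have hs : Submodule.span ℝ {(Projectivization.mk ℝ w hw).rep} = Submodule.span ℝ {w} := by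
    rw [← Projectivization.submodule_eq, Projectivization.submodule_mk]
  have hm : (Projectivization.mk ℝ w hw).rep ∈ LinearMap.ker (f i) ⊓ LinearMap.ker (f j) := by
    rw [h, ← hs]; exact Submodule.mem_span_singleton_self _
  refine ⟨Projectivization.mk ℝ w hw, by rw [h, hs], hm.1, hm.2, fun q hi hj => ?_⟩
  have hq : q.rep ∈ LinearMap.ker (f i) ⊓ LinearMap.ker (f j) := ⟨hi, hj⟩
  rw [h, Submodule.mem_span_singleton] at hq
  obtain ⟨c, hc⟩ := hq
  rw [← q.mk_rep, Projectivization.mk_eq_mk_iff']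
  exact ⟨c, hc⟩

theorem IsLineFamily.eq_of_mem (hf : IsLineFamily f) {i j : ι} (hij : i ≠ j) {p q : ℙ ℝ V}
    (hpi : f i p.rep = 0) (hpj : f j p.rep = 0) (hqi : f i q.rep = 0) (hqj : f j q.rep = 0) :
    p = q := by
  obtain ⟨x, -, -, -, hx⟩ := hf.exists_point hij
  rw [hx p hpi hpj, hx q hqi hqj]

open Classical in
/-- The number of lines of `A` through `p`. -/
noncomputable def multIn (f : ι → V →ₗ[ℝ] ℝ) (A : Finset ι) (p : ℙ ℝ V) : ℕ :=
  (A.filter fun i => f i p.rep = 0).card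

open Classical in
/-- The points of `P` on the line `l` that also lie on a line of `A`. -/
noncomputable def pointsOn (f : ι → V →ₗ[ℝ] ℝ) (P : Finset (ℙ ℝ V)) (A : Finset ι) (l : ι) :
    Finset (ℙ ℝ V) :=
  P.filter fun p => f l p.rep = 0 ∧ ∃ j ∈ A, f j p.rep = 0

variable [DecidableEq ι]

/-- In the plane `f l = 0` the other forms cut out lines through the origin, and n ≥ 1 of these make
2n sectors. In the induction a new form adds two half-lines if its point on `l` is new, and nothing
otherwise. -/
theorem card_signRegions_ker (hf : IsLineFamily f) (hP : IsMultiplePoints f P) {l : ι}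
    (hA : A.Nonempty) (hl : l ∉ A) :
    (signRegions f (LinearMap.ker (f l)) A).card = 2 * (pointsOn f P A l).card := by
  classical
  induction hA using Finset.Nonempty.cons_induction with
  | singleton i =>
    have hli : l ≠ i := by simpa using hl
    obtain ⟨w, hw, hiw⟩ := hf.exists_ne_of_ne l i hli
    obtain ⟨p, -, hpl, hpi, hp⟩ := hf.exists_point hli
    have h1 : pointsOn f P {i} l = {p} := by
      ext q
      simp only [pointsOn, Finset.mem_filter, Finset.mem_singleton, exists_eq_left]
      constructor
      · rintro ⟨-, h1, h2⟩
        exact hp q h1 h2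
      · rintro rfl
        exact ⟨(hP _).2 ⟨l, i, hli, hpl, hpi⟩, hpl, hpi⟩
    have h2 := card_signRegions_insert (f := f) (W := LinearMap.ker (f l)) (A := ∅) (i := i)
      (by simp) hw hiw
    simp only [insert_empty_eq, signRegions_empty, Finset.card_singleton] at h2
    rw [h1, h2, Finset.card_singleton]
  | cons i A hi hA ih =>
    rw [Finset.cons_eq_insert] at hl ⊢
    rw [Finset.mem_insert, not_or] at hl
    obtain ⟨w, hw, hiw⟩ := hf.exists_ne_of_ne l i hl.1
    obtain ⟨p, hker, hpl, hpi, hp⟩ := hf.exists_point hl.1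
    have h1 : pointsOn f P (insert i A) l = insert p (pointsOn f P A l) := by
      ext q
      simp only [pointsOn, Finset.mem_filter, Finset.mem_insert, exists_eq_or_imp]
      constructor
      · rintro ⟨h0, h1, h2 | h2⟩
        · exact Or.inl (hp q h1 h2)
        · exact Or.inr ⟨h0, h1, h2⟩
      · rintro (rfl | ⟨h0, h1, h2⟩)
        · exact ⟨(hP _).2 ⟨l, i, hl.1, hpl, hpi⟩, hpl, Or.inl hpi⟩
        · exact ⟨h0, h1, Or.inr h2⟩
    rw [card_signRegions_insert hi hw hiw, ih hl.2, h1, hker]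
    by_cases hex : ∃ j ∈ A, f j p.rep = 0
    · obtain ⟨j, hj, hjp⟩ := hex
      rw [signRegions_span_singleton_of_eq_zero hj hjp, Finset.insert_eq_of_mem]
      · simp
      · exact Finset.mem_filter.2 ⟨(hP _).2 ⟨l, i, hl.1, hpl, hpi⟩, hpl, j, hj, hjp⟩
    · rw [Finset.card_insert_of_notMem, card_signRegions_span_singleton hA]
      · ring
      · exact fun j hj h => hex ⟨j, hj, h⟩
      · exact fun h => hex (Finset.mem_filter.1 h).2.2

/-- Truncated subtraction matters here: a point of `P` on no line of `A` contributes 0 and still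
contributes 0 once line `i` passes through it. Only points already on a line of `A` gain 1. -/
theorem sum_multIn_sub_one_insert {i : ι} (hi : i ∉ A) :
    ∑ p ∈ P, (multIn f (insert i A) p - 1) =
      ∑ p ∈ P, (multIn f A p - 1) + (pointsOn f P A i).card := by
  classical
  rw [pointsOn, Finset.card_filter, ← Finset.sum_add_distrib]
  refine Finset.sum_congr rfl fun p _ => ?_
  have hex : (∃ j ∈ A, f j p.rep = 0) ↔ 0 < multIn f A p := by
    rw [multIn, Finset.card_pos, Finset.filter_nonempty_iff]
  have hins : multIn f (insert i A) p = multIn f A p + if f i p.rep = 0 then 1 else 0 := by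
    rw [multIn, multIn, Finset.filter_insert]
    split_ifs
    · rw [Finset.card_insert_of_notMem (by simp [hi])]
    · rfl
  rw [hins]
  by_cases h1 : f i p.rep = 0 <;> by_cases h2 : 0 < multIn f A p <;> simp [h1, hex, h2] <;> omega

omit [DecidableEq ι] in
theorem sum_multIn_sub_one_singleton (i : ι) : ∑ p ∈ P, (multIn f {i} p - 1) = 0 := by
  classical
  refine Finset.sum_eq_zero fun p _ => ?_
  have : multIn f {i} p ≤ 1 := by
    simpa [multIn] using Finset.card_filter_le ({i} : Finset ι) fun i => f i p.rep = 0
  omega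

/-- The number of cones cut out by the planes `f i = 0`, `i ∈ A`. -/
theorem card_signRegions_top (hf : IsLineFamily f) (hP : IsMultiplePoints f P)
    (hA : A.Nonempty) :
    (signRegions f ⊤ A).card = 2 * (1 + ∑ p ∈ P, (multIn f A p - 1)) := by
  classical
  induction hA using Finset.Nonempty.cons_induction with
  | singleton i =>
    obtain ⟨w, hiw⟩ := hf.exists_ne i
    have h2 := card_signRegions_insert (f := f) (W := ⊤) (A := ∅) (i := i)
      (by simp) (Submodule.mem_top (x := w)) hiw
    simp only [insert_empty_eq, signRegions_empty, Finset.card_singleton] at h2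
    rw [h2, sum_multIn_sub_one_singleton]
  | cons i A hi hA ih =>
    rw [Finset.cons_eq_insert]
    obtain ⟨w, hiw⟩ := hf.exists_ne i
    rw [card_signRegions_insert hi Submodule.mem_top hiw, ih, top_inf_eq,
      card_signRegions_ker hf hP hA hi, sum_multIn_sub_one_insert hi]
    ring

/-- There are `2r` cones around a line on which `r` of the forms vanish. -/
theorem card_signRegions_filter (hf : IsLineFamily f) (hP : IsMultiplePoints f P)
    {p : ℙ ℝ V} (hp : p ∈ P) (hA : ∀ i, i ∈ A ↔ f i p.rep = 0) :
    (signRegions f ⊤ A).card = 2 * A.card := by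
  classical
  obtain ⟨i, j, hij, hi, hj⟩ := (hP p).1 hp
  have hAne : A.Nonempty := ⟨i, (hA i).2 hi⟩
  have hpA : multIn f A p = A.card := by
    rw [multIn, Finset.filter_true_of_mem fun i hi => (hA i).1 hi]
  -- All lines of `A` pass through `p`, so any other point lies on at most one of them and its
  -- summand is 0.
  rw [card_signRegions_top hf hP hAne, Finset.sum_eq_single_of_mem p hp, hpA]
  · have := hAne.card_pos
    omega
  · intro q hq hqp
    have : multIn f A q ≤ 1 := by
      rw [multIn, Finset.card_le_one]
      intro k hk l hl
      rw [Finset.mem_filter] at hk hl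
      by_contra hkl
      exact hqp (hf.eq_of_mem hkl hk.2 hl.2 ((hA k).1 hk.1) ((hA l).1 hl.1))
    omega

variable [Fintype ι]

/-- The vector `v` lies in the closed cone belonging to the set `S` of positive forms. -/
def InClosedCone (f : ι → V →ₗ[ℝ] ℝ) (S : Finset ι) (v : V) : Prop :=
  (∀ i ∈ S, 0 ≤ f i v) ∧ ∀ i ∉ S, f i v ≤ 0

open Classical in
/-- The cones whose closure contains `v` correspond to those of the subfamily of the forms that
vanish at `v`. -/
theorem card_filter_inClosedCone (v : V) (hA : ∀ i, i ∈ A ↔ f i v = 0) :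
    ((signRegions f ⊤ Finset.univ).filter fun S => InClosedCone f S v).card =
      (signRegions f ⊤ A).card := by
  -- Near `v` only the forms vanishing at `v` can change sign. The inverse map is realised by `v + ε
  -- • w`: forms nonzero at `v` keep their sign, the others take that of `w`.
  refine Finset.card_bij' (fun S _ => S ∩ A)
    (fun T _ => T ∪ Finset.univ.filter fun i => 0 < f i v) ?_ ?_ ?_ ?_
  · intro S hS
    obtain ⟨hS, hc⟩ := Finset.mem_filter.1 hS
    obtain ⟨-, w, -, hp, hn⟩ := mem_signRegions.1 hS
    refine mem_signRegions.2 ⟨Finset.inter_subset_right, w, Submodule.mem_top,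
      fun i hi => hp i (Finset.mem_inter.1 hi).1, fun i hi hiS => hn i (Finset.mem_univ _) ?_⟩
    exact fun h => hiS (Finset.mem_inter.2 ⟨h, hi⟩)
  · intro T hT
    obtain ⟨hTA, w, -, hp, hn⟩ := mem_signRegions.1 hT
    obtain ⟨ε, hε, hε'⟩ := exists_pos_forall_pos_add_smul f Finset.univ v w
    have hz : ∀ i ∈ A, f i (v + ε • w) = ε * f i w := fun i hi => by simp [(hA i).1 hi]
    rw [Finset.mem_filter, mem_signRegions]
    refine ⟨⟨Finset.subset_univ _, v + ε • w, Submodule.mem_top, ?_, ?_⟩, ?_, ?_⟩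
    · intro i hi
      rcases Finset.mem_union.1 hi with hi | hi
      · rw [hz i (hTA hi)]
        exact mul_pos hε (hp i hi)
      · exact (hε' i (Finset.mem_univ _)).1 (Finset.mem_filter.1 hi).2
    · intro i _ hi
      simp only [Finset.mem_union, Finset.mem_filter, Finset.mem_univ, true_and, not_or,
        not_lt] at hi
      by_cases hiA : i ∈ A
      · rw [hz i hiA]
        exact mul_neg_of_pos_of_neg hε (hn i hiA hi.1)
      · exact (hε' i (Finset.mem_univ _)).2 (lt_of_le_of_ne hi.2 fun h => hiA ((hA i).2 h))
    · intro i hi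
      rcases Finset.mem_union.1 hi with hi | hi
      · exact ((hA i).1 (hTA hi)).ge
      · exact (Finset.mem_filter.1 hi).2.le
    · intro i hi
      simp only [Finset.mem_union, Finset.mem_filter, Finset.mem_univ, true_and, not_or,
        not_lt] at hi
      exact hi.2
  · intro S hS
    obtain ⟨hS, hc⟩ := Finset.mem_filter.1 hS
    ext i
    simp only [Finset.mem_union, Finset.mem_inter, Finset.mem_filter, Finset.mem_univ, true_and]
    constructor
    · rintro (h | h)
      · exact h.1
      · by_contra hi
        exact (hc.2 i hi).not_gt h
    · intro hi
      rcases (hc.1 i hi).eq_or_lt with h | h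
      · exact Or.inl ⟨hi, (hA i).2 h.symm⟩
      · exact Or.inr h
  · intro T hT
    obtain ⟨hTA, -⟩ := mem_signRegions.1 hT
    ext i
    simp only [Finset.mem_union, Finset.mem_inter, Finset.mem_filter, Finset.mem_univ, true_and]
    constructor
    · rintro ⟨h | h, hi⟩
      · exact h
      · exact absurd ((hA i).1 hi) h.ne'
    · exact fun h => ⟨Or.inl h, hTA h⟩

open Classical in
/-- The vertices of a cone, as points of the projective plane. -/
noncomputable def coneVertices (f : ι → V →ₗ[ℝ] ℝ) (P : Finset (ℙ ℝ V)) (S : Finset ι) :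
    Finset (ℙ ℝ V) :=
  P.filter fun p => InClosedCone f S p.rep ∨ InClosedCone f S (-p.rep)

/-- Every multiple point of multiplicity `r` is a vertex of `4r` cones. -/
theorem sum_card_coneVertices (hf : IsLineFamily f) (hP : IsMultiplePoints f P)
    (hrank : ∀ p : ℙ ℝ V, ∃ i, f i p.rep ≠ 0) :
    ∑ S ∈ signRegions f ⊤ Finset.univ, (coneVertices f P S).card =
      4 * ∑ p ∈ P, multIn f Finset.univ p := by
  classical
  simp only [coneVertices, Finset.card_filter]
  rw [Finset.sum_comm, Finset.mul_sum]
  refine Finset.sum_congr rfl fun p hp => ?_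
  -- 4r is 2r cones around each of `p.rep` and `-p.rep`. No closed cone contains both, since all
  -- forms would then vanish at `p`.
  rw [← Finset.card_filter, Finset.filter_or, Finset.card_union_of_disjoint]
  · have hA : ∀ i, i ∈ (Finset.univ.filter fun i => f i p.rep = 0) ↔ f i p.rep = 0 := by simp
    rw [card_filter_inClosedCone p.rep hA, card_filter_inClosedCone (-p.rep)
      (A := Finset.univ.filter fun i => f i p.rep = 0) (by simp),
      card_signRegions_filter hf hP hp hA, multIn]
    ring
  · rw [Finset.disjoint_left]
    intro S hS hS'
    have h := (Finset.mem_filter.1 hS).2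
    have h' := (Finset.mem_filter.1 hS').2
    obtain ⟨i, hi⟩ := hrank p
    apply hi
    by_cases hiS : i ∈ S
    · have := h.1 i hiS
      have := h'.1 i hiS
      rw [map_neg] at this
      linarith
    · have := h.2 i hiS
      have := h'.2 i hiS
      rw [map_neg] at this
      linarith

end Arrangement

/-! ### Polyhedral cones, their vertices, and simplicial cones -/

section Cones

variable {ι V : Type*} [AddCommGroup V] [Module ℝ V] [Fintype ι]

/-- A point of a polyhedral cone can be moved in a direction that leaves the cone until one more
of the defining inequalities becomes tight. -/
theorem exists_pos_tight (g : ι → V →ₗ[ℝ] ℝ) {v w : V} (hv : ∀ i, 0 ≤ g i v)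
    (hw : ∀ i, g i v = 0 → g i w = 0) (hneg : ∃ i, g i w < 0) :
    ∃ t : ℝ, 0 < t ∧ (∀ i, 0 ≤ g i (v + t • w)) ∧ ∃ i, g i v ≠ 0 ∧ g i (v + t • w) = 0 := by
  classical
  obtain ⟨k, hk⟩ := hneg
  -- Ratio test: `i` is the first of the decreasing forms to reach zero along `w`.
  obtain ⟨i, hi, hmin⟩ := Finset.exists_min_image (Finset.univ.filter fun i => g i w < 0)
    (fun i => g i v / -g i w) ⟨k, by simpa using hk⟩
  have hi : g i w < 0 := by simpa using hi
  have hiv : g i v ≠ 0 := fun h => hi.ne (hw i h)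
  refine ⟨g i v / -g i w, div_pos (lt_of_le_of_ne (hv i) hiv.symm) (neg_pos.2 hi), fun j => ?_,
    i, hiv, ?_⟩
  · have ht : 0 ≤ g i v / -g i w := div_nonneg (hv i) (neg_pos.2 hi).le
    simp only [map_add, map_smul, smul_eq_mul]
    rcases lt_or_ge (g j w) 0 with hj | hj
    · have h := hmin j (by simpa using hj)
      rw [le_div_iff₀ (neg_pos.2 hj)] at h
      linarith
    · have := hv j
      positivity
  · rw [map_add, map_smul, smul_eq_mul, div_mul_eq_mul_div, div_neg, mul_div_cancel_right₀ _ hi.ne,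
      add_neg_cancel]

/-- A pointed polyhedral cone in a three-dimensional space is generated by the vectors in it at
which two of the defining inequalities are tight. -/
theorem mem_of_forall_nonneg (g : ι → V →ₗ[ℝ] ℝ) (hrank : ∀ v, (∀ i, g i v = 0) → v = 0)
    (hdim : ∀ h k : V →ₗ[ℝ] ℝ, ∃ w, w ≠ 0 ∧ h w = 0 ∧ k w = 0) (C : Set V) (h0 : (0 : V) ∈ C)
    (hadd : ∀ x ∈ C, ∀ y ∈ C, x + y ∈ C)
    (hC : ∀ v, v ≠ 0 → (∀ i, 0 ≤ g i v) → (∃ i j, i ≠ j ∧ g i v = 0 ∧ g j v = 0) → v ∈ C)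
    (v : V) (hv : ∀ i, 0 ≤ g i v) : v ∈ C := by
  classical
  -- Induction on the number of inequalities that are not tight at `v`.
  induction hn : (Finset.univ.filter fun i => g i v ≠ 0).card using Nat.strong_induction_on
    generalizing v with
  | _ n ih =>
  by_cases hv0 : v = 0
  · rwa [hv0]
  by_cases hex : ∃ i j, i ≠ j ∧ g i v = 0 ∧ g j v = 0
  · exact hC v hv0 hv hex
  obtain ⟨k, hk⟩ : ∃ k : V →ₗ[ℝ] ℝ, ∀ i, g i v = 0 → g i = k := by
    by_cases h : ∃ i, g i v = 0
    · obtain ⟨i, hi⟩ := h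
      refine ⟨g i, fun j hj => ?_⟩
      by_contra hne
      exact hex ⟨j, i, fun h => hne (by rw [h]), hj, hi⟩
    · exact ⟨0, fun i hi => absurd ⟨i, hi⟩ h⟩
  -- Since `k w = 0`, tight inequalities stay tight along `w`. Since the forms sum to 0 at `w` but
  -- do not all vanish there, both signs occur, so the line through `v` leaves the cone in both
  -- directions and `v` lies between two points with more tight inequalities.
  obtain ⟨w, hw, hsum, hkw⟩ := hdim (∑ i, g i) k
  have hzero : ∀ i, g i v = 0 → g i w = 0 := fun i hi => by rw [hk i hi, hkw]
  rw [LinearMap.sum_apply] at hsum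
  obtain ⟨m, hm⟩ : ∃ i, g i w ≠ 0 := by
    by_contra! h
    exact hw (hrank w h)
  have hneg : ∃ i, g i w < 0 := by
    by_contra! h
    exact hm ((Finset.sum_eq_zero_iff_of_nonneg fun i _ => h i).1 hsum m (Finset.mem_univ _))
  have hpos : ∃ i, g i (-w) < 0 := by
    by_contra! h
    simp only [map_neg, Left.nonneg_neg_iff] at h
    exact hm ((Finset.sum_eq_zero_iff_of_nonpos fun i _ => h i).1 hsum m (Finset.mem_univ _))
  have key : ∀ u, (∀ i, g i v = 0 → g i u = 0) → (∃ i, g i u < 0) →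
      ∃ t : ℝ, 0 < t ∧ ∀ a : ℝ, 0 < a → a • (v + t • u) ∈ C := by
    intro u hu hu'
    obtain ⟨t, ht, htn, i, hi, hit⟩ := exists_pos_tight g hv hu hu'
    refine ⟨t, ht, fun a ha => ?_⟩
    refine ih _ ?_ _ (fun j => ?_) rfl
    · rw [← hn]
      apply Finset.card_lt_card
      rw [Finset.ssubset_iff_of_subset]
      · exact ⟨i, by simpa using hi, by rw [Finset.mem_filter, map_smul, hit]; simp⟩
      · intro j hj
        simp only [Finset.mem_filter, Finset.mem_univ, true_and] at hj ⊢
        intro h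
        apply hj
        simp [h, hu j h]
    · rw [map_smul, smul_eq_mul]
      exact mul_nonneg ha.le (htn j)
  obtain ⟨t, ht, hta⟩ := key w hzero hneg
  obtain ⟨s, hs, hsa⟩ := key (-w) (fun i hi => by rw [map_neg, hzero i hi, neg_zero]) hpos
  have hst : s + t ≠ 0 := (add_pos hs ht).ne'
  have : v = (s / (s + t)) • (v + t • w) + (t / (s + t)) • (v + s • -w) := by
    have h1 : s / (s + t) + t / (s + t) = 1 := by field_simp
    calc v = (s / (s + t) + t / (s + t)) • v := by rw [h1, one_smul]
      _ = _ := by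
        have h2 : s / (s + t) * t = t / (s + t) * s := by ring
        rw [smul_add, smul_add, smul_smul, smul_smul, h2, smul_neg, add_smul]
        abel
  rw [this]
  exact hadd _ (hta _ (by positivity)) _ (hsa _ (by positivity))

open Classical in
/-- The forms `f i` with signs such that they are positive on the cone belonging to `S`. -/
noncomputable def signedForm (f : ι → V →ₗ[ℝ] ℝ) (S : Finset ι) (i : ι) : V →ₗ[ℝ] ℝ :=
  if i ∈ S then f i else -f i

/-- The open cone on which exactly the forms `f i`, `i ∈ S`, are positive and the others are
negative. -/
def InOpenCone (f : ι → V →ₗ[ℝ] ℝ) (S : Finset ι) (v : V) : Prop :=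
  (∀ i ∈ S, 0 < f i v) ∧ ∀ i ∉ S, f i v < 0

variable {f : ι → V →ₗ[ℝ] ℝ} {P : Finset (ℙ ℝ V)} {S : Finset ι}

omit [Fintype ι] in
theorem inClosedCone_iff {v : V} : InClosedCone f S v ↔ ∀ i, 0 ≤ signedForm f S i v := by
  simp only [InClosedCone, signedForm]
  refine ⟨fun h i => ?_, fun h => ⟨fun i hi => ?_, fun i hi => ?_⟩⟩
  · split_ifs with hi
    · exact h.1 i hi
    · simpa using h.2 i hi
  · simpa [hi] using h i
  · simpa [hi] using h i

omit [Fintype ι] in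
theorem inOpenCone_iff {v : V} : InOpenCone f S v ↔ ∀ i, 0 < signedForm f S i v := by
  simp only [InOpenCone, signedForm]
  refine ⟨fun h i => ?_, fun h => ⟨fun i hi => ?_, fun i hi => ?_⟩⟩
  · split_ifs with hi
    · exact h.1 i hi
    · simpa using h.2 i hi
  · simpa [hi] using h i
  · simpa [hi] using h i

omit [Fintype ι] in
theorem signedForm_eq_zero_iff {i : ι} {v : V} : signedForm f S i v = 0 ↔ f i v = 0 := by
  simp only [signedForm]
  split_ifs <;> simp

omit [Fintype ι] in
theorem InOpenCone.inClosedCone {v : V} (h : InOpenCone f S v) : InClosedCone f S v :=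
  ⟨fun i hi => (h.1 i hi).le, fun i hi => (h.2 i hi).le⟩

theorem mem_signRegions_univ : S ∈ signRegions f ⊤ Finset.univ ↔ ∃ v, InOpenCone f S v := by
  simp [mem_signRegions, InOpenCone]

theorem InOpenCone.exists_add_smul {v : V} (h : InOpenCone f S v) (w : V) :
    ∃ ε : ℝ, 0 < ε ∧ InOpenCone f S (v + ε • w) := by
  obtain ⟨ε, hε, hε'⟩ := exists_pos_forall_pos_add_smul f Finset.univ v w
  exact ⟨ε, hε, fun i hi => (hε' i (Finset.mem_univ _)).1 (h.1 i hi),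
    fun i hi => (hε' i (Finset.mem_univ _)).2 (h.2 i hi)⟩

omit [Fintype ι] in
theorem InClosedCone.eq_zero (hrank : ∀ v, (∀ i, f i v = 0) → v = 0) {v : V}
    (h : InClosedCone f S v) (h' : InClosedCone f S (-v)) : v = 0 := by
  refine hrank v fun i => ?_
  by_cases hi : i ∈ S
  · have h1 := h.1 i hi
    have h2 := h'.1 i hi
    rw [map_neg] at h2
    linarith
  · have h1 := h.2 i hi
    have h2 := h'.2 i hi
    rw [map_neg] at h2
    linarith

open Classical in
/-- The representative in the closed cone of a vertex. -/
noncomputable def vertexRep (f : ι → V →ₗ[ℝ] ℝ) (S : Finset ι) (p : ℙ ℝ V) : V :=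
  if InClosedCone f S p.rep then p.rep else -p.rep

omit [Fintype ι] in
theorem vertexRep_mem {p : ℙ ℝ V} (hp : p ∈ coneVertices f P S) :
    InClosedCone f S (vertexRep f S p) := by
  classical
  have h := (Finset.mem_filter.1 hp).2
  rw [vertexRep]
  split_ifs with h'
  · exact h'
  · exact h.resolve_left h'

omit [Fintype ι] in
theorem vertexRep_eq (p : ℙ ℝ V) : vertexRep f S p = p.rep ∨ vertexRep f S p = -p.rep := by
  rw [vertexRep]
  split_ifs <;> simp

omit [Fintype ι] in
theorem vertexRep_ne_zero (p : ℙ ℝ V) : vertexRep f S p ≠ 0 := by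
  rcases vertexRep_eq (f := f) (S := S) p with h | h <;> simp [h, p.rep_nonzero]

/-- Minkowski's theorem for a closed cone: `mem_of_forall_nonneg` reduces it to vectors with two
tight inequalities, and these span multiple points. -/
theorem InClosedCone.exists_eq_sum (hP : IsMultiplePoints f P)
    (hrank : ∀ v, (∀ i, f i v = 0) → v = 0)
    (hdim : ∀ h k : V →ₗ[ℝ] ℝ, ∃ w, w ≠ 0 ∧ h w = 0 ∧ k w = 0) {v : V}
    (hv : InClosedCone f S v) :
    ∃ c : ℙ ℝ V → ℝ, (∀ p, 0 ≤ c p) ∧ v = ∑ p ∈ coneVertices f P S, c p • vertexRep f S p := by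
  classical
  refine mem_of_forall_nonneg (signedForm f S)
    (fun v h => hrank v fun i => signedForm_eq_zero_iff.1 (h i)) hdim
    {v | ∃ c : ℙ ℝ V → ℝ, (∀ p, 0 ≤ c p) ∧
      v = ∑ p ∈ coneVertices f P S, c p • vertexRep f S p} ⟨0, by simp, by simp⟩ ?_ ?_ v
    (inClosedCone_iff.1 hv)
  · rintro x ⟨c, hc, rfl⟩ y ⟨c', hc', rfl⟩
    refine ⟨c + c', fun p => add_nonneg (hc p) (hc' p), ?_⟩
    simp [add_smul, Finset.sum_add_distrib]
  · rintro w hw hwc ⟨i, j, hij, hi, hj⟩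
    have hwc := inClosedCone_iff.2 hwc
    rw [signedForm_eq_zero_iff] at hi hj
    obtain ⟨a, ha⟩ := Projectivization.exists_smul_eq_mk_rep ℝ w hw
    set p := Projectivization.mk ℝ w hw
    rw [Units.smul_def] at ha
    have hpP : p ∈ P := (hP p).2 ⟨i, j, hij, by rw [← ha, map_smul, hi, smul_zero],
      by rw [← ha, map_smul, hj, smul_zero]⟩
    have hpos : ∀ b : ℝ, 0 < b → InClosedCone f S (b • w) := fun b hb => by
      rw [inClosedCone_iff] at hwc ⊢
      intro k
      rw [map_smul]
      exact mul_nonneg hb.le (hwc k)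
    have hpT : p ∈ coneVertices f P S := by
      refine Finset.mem_filter.2 ⟨hpP, ?_⟩
      rcases lt_or_gt_of_ne a.ne_zero with h | h
      · right
        rw [← ha, ← neg_smul]
        exact hpos _ (neg_pos.2 h)
      · left
        rw [← ha]
        exact hpos _ h
    obtain ⟨b, hb⟩ : ∃ b : ℝ, vertexRep f S p = b • w := by
      rcases vertexRep_eq (f := f) (S := S) p with h | h
      · exact ⟨a, by rw [h, ha]⟩
      · exact ⟨-a, by rw [h, ← ha, neg_smul]⟩
    -- A negative `b` would put both `vertexRep f S p` and its negative in the closed cone, which is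
    -- pointed.
    have hbpos : 0 < b := by
      by_contra hb'
      rcases (not_lt.1 hb').eq_or_lt with h | h
      · exact vertexRep_ne_zero (f := f) (S := S) p (by rw [hb, h, zero_smul])
      · refine vertexRep_ne_zero (f := f) (S := S) p ((vertexRep_mem hpT).eq_zero hrank ?_)
        rw [hb, ← neg_smul]
        exact hpos _ (neg_pos.2 h)
    refine ⟨Pi.single p b⁻¹, fun q => ?_, ?_⟩
    · by_cases hq : q = p
      · subst hq
        simpa using hbpos.le
      · simp [hq]
    · rw [Finset.sum_eq_single_of_mem p hpT]
      · rw [Pi.single_eq_same, hb, smul_smul, inv_mul_cancel₀ hbpos.ne', one_smul]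
      · intro q _ hq
        rw [Pi.single_eq_of_ne hq, zero_smul]

/-- The span contains the open cone, and any `v` is a multiple of a difference of two points of that
cone. -/
theorem span_vertexRep (hP : IsMultiplePoints f P)
    (hrank : ∀ v, (∀ i, f i v = 0) → v = 0)
    (hdim : ∀ h k : V →ₗ[ℝ] ℝ, ∃ w, w ≠ 0 ∧ h w = 0 ∧ k w = 0) {x : V}
    (hx : InOpenCone f S x) :
    Submodule.span ℝ (vertexRep f S '' (coneVertices f P S : Set (ℙ ℝ V))) = ⊤ := by
  have key : ∀ y, InOpenCone f S y →
      y ∈ Submodule.span ℝ (vertexRep f S '' (coneVertices f P S : Set (ℙ ℝ V))) := by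
    intro y hy
    obtain ⟨c, -, rfl⟩ := hy.inClosedCone.exists_eq_sum hP hrank hdim
    exact Submodule.sum_mem _ fun p hp =>
      Submodule.smul_mem _ _ (Submodule.subset_span ⟨p, hp, rfl⟩)
  refine Submodule.eq_top_iff'.2 fun v => ?_
  obtain ⟨ε, hε, h⟩ := hx.exists_add_smul v
  have h2 := Submodule.sub_mem _ (key _ h) (key _ hx)
  rw [add_sub_cancel_left] at h2
  exact (Submodule.smul_mem_iff _ hε.ne').1 h2

theorem exists_common_zero (hfin : Module.finrank ℝ V = 3) (h k : V →ₗ[ℝ] ℝ) :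
    ∃ w, w ≠ 0 ∧ h w = 0 ∧ k w = 0 := by
  have : FiniteDimensional ℝ V := .of_finrank_pos (by omega)
  have hker : LinearMap.ker (h.prod k) ≠ ⊥ := by
    apply LinearMap.ker_ne_bot_of_finrank_lt
    simp [hfin]
  obtain ⟨w, hw, hw0⟩ := Submodule.exists_mem_ne_zero_of_ne_bot hker
  rw [LinearMap.mem_ker, LinearMap.prod_apply, Prod.mk_eq_zero] at hw
  exact ⟨w, hw0, hw.1, hw.2⟩

theorem three_le_card_coneVertices (hP : IsMultiplePoints f P)
    (hrank : ∀ v, (∀ i, f i v = 0) → v = 0) (hfin : Module.finrank ℝ V = 3) {x : V}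
    (hx : InOpenCone f S x) : 3 ≤ (coneVertices f P S).card := by
  classical
  have h := span_vertexRep hP hrank (exists_common_zero hfin) hx
  rw [← Finset.coe_image] at h
  have h2 := finrank_span_finset_le_card (R := ℝ) ((coneVertices f P S).image (vertexRep f S))
  rw [Set.finrank, h, finrank_top, hfin] at h2
  exact h2.trans Finset.card_image_le

/-- A cone with three vertices is simplicial. -/
theorem exists_simplicial_of_card_eq_three (hP : IsMultiplePoints f P)
    (hfne : ∀ i, ∃ w, f i w ≠ 0)
    (hrank : ∀ v, (∀ i, f i v = 0) → v = 0) (hfin : Module.finrank ℝ V = 3) {x : V}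
    (hx : InOpenCone f S x) (hcard : (coneVertices f P S).card = 3) :
    ∃ v : Fin 3 → V, LinearIndependent ℝ v ∧
      ∀ y, InOpenCone f S y ↔ ∃ c : Fin 3 → ℝ, (∀ i, 0 < c i) ∧ y = ∑ i, c i • v i := by
  classical
  have hdim := exists_common_zero hfin
  let e : Fin 3 ≃ coneVertices f P S :=
    (finCongr hcard.symm).trans (coneVertices f P S).equivFin.symm
  let v : Fin 3 → V := fun i => vertexRep f S (e i)
  have hspan : Submodule.span ℝ (Set.range v) = ⊤ := by
    rw [← span_vertexRep hP hrank hdim hx]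
    congr 1
    ext y
    constructor
    · rintro ⟨i, rfl⟩
      exact ⟨e i, (e i).2, rfl⟩
    · rintro ⟨p, hp, rfl⟩
      exact ⟨e.symm ⟨p, hp⟩, by simp [v]⟩
  have hli : LinearIndependent ℝ v :=
    linearIndependent_of_top_le_span_of_card_eq_finrank hspan.ge (by simp [hfin])
  have hmink : ∀ y, InClosedCone f S y → ∃ c : Fin 3 → ℝ, (∀ i, 0 ≤ c i) ∧ y = ∑ i, c i • v i := by
    intro y hy
    obtain ⟨c, hc, rfl⟩ := hy.exists_eq_sum hP hrank hdim
    refine ⟨fun i => c (e i), fun i => hc _, ?_⟩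
    rw [← Finset.sum_coe_sort, ← e.sum_comp]
  have hvK : ∀ i j, 0 ≤ signedForm f S j (v i) :=
    fun i => inClosedCone_iff.1 (vertexRep_mem (e i).2)
  refine ⟨v, hli, fun y => ⟨fun hy => ?_, ?_⟩⟩
  · obtain ⟨c, hc, hyc⟩ := hmink y hy.inClosedCone
    refine ⟨c, fun i => lt_of_le_of_ne (hc i) fun hci => ?_, hyc⟩
    -- If the `i`-th coordinate of `y` were 0, a small step along `-v i` would stay in the cone with
    -- a negative coordinate.
    obtain ⟨ε, hε, h⟩ := hy.exists_add_smul (-v i)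
    obtain ⟨c', hc', h'⟩ := hmink _ h.inClosedCone
    have heq : ∑ j, (c j - ε * (if j = i then 1 else 0)) • v j = ∑ j, c' j • v j := by
      rw [← h', hyc]
      simp only [sub_smul, Finset.sum_sub_distrib]
      simp [sub_eq_add_neg]
    have := Fintype.linearIndependent_iff.1 hli
      (fun j => (c j - ε * (if j = i then 1 else 0)) - c' j)
      (by simp only [sub_smul, Finset.sum_sub_distrib] at heq ⊢; rw [heq, sub_self]) i
    have h3 := hc' i
    simp only [if_true, ← hci] at this
    linarith
  · rintro ⟨c, hc, rfl⟩
    rw [inOpenCone_iff]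
    intro j
    simp only [map_sum, map_smul, smul_eq_mul]
    -- A nonnegative form vanishing at a strictly positive combination vanishes on the whole basis,
    -- so it is zero.
    refine lt_of_le_of_ne (Finset.sum_nonneg fun i _ => mul_nonneg (hc i).le (hvK i j))
      fun h0 => ?_
    have hz := (Finset.sum_eq_zero_iff_of_nonneg
      fun i _ => mul_nonneg (hc i).le (hvK i j)).1 h0.symm
    obtain ⟨w, hw⟩ := hfne j
    apply hw
    have hw' : w ∈ Submodule.span ℝ (Set.range v) := hspan ▸ Submodule.mem_top
    have hle : Submodule.span ℝ (Set.range v) ≤ LinearMap.ker (f j) := by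
      rw [Submodule.span_le]
      rintro _ ⟨i, rfl⟩
      exact signedForm_eq_zero_iff.1
        ((mul_eq_zero.1 (hz i (Finset.mem_univ _))).resolve_left (hc i).ne')
    exact hle hw'

omit [Fintype ι] in
/-- A simplicial cone has at most three vertices. -/
theorem card_coneVertices_le_three (hf : IsLineFamily f) (hP : IsMultiplePoints f P)
    (hfin : Module.finrank ℝ V = 3) {v : Fin 3 → V} (hli : LinearIndependent ℝ v)
    (h : ∀ y, InOpenCone f S y ↔ ∃ c : Fin 3 → ℝ, (∀ i, 0 < c i) ∧ y = ∑ i, c i • v i) :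
    (coneVertices f P S).card ≤ 3 := by
  classical
  have hx : InOpenCone f S (∑ i, v i) := (h _).2 ⟨1, fun _ => one_pos, by simp⟩
  have hspan : ⊤ ≤ Submodule.span ℝ (Set.range v) :=
    (hli.span_eq_top_of_card_eq_finrank (by simp [hfin])).ge
  -- If form `j` were negative at `v k`, moving far enough along `v k` would make it zero at a point
  -- that `h` puts in the open cone.
  have hvK : ∀ k j, 0 ≤ signedForm f S j (v k) := by
    intro k j
    by_contra hneg
    push Not at hneg
    have hpos := inOpenCone_iff.1 hx j
    set g := signedForm f S j
    have : InOpenCone f S (∑ i, v i + (g (∑ i, v i) / -g (v k)) • v k) := by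
      refine (h _).2 ⟨fun i => 1 + if i = k then g (∑ i, v i) / -g (v k) else 0,
        fun i => ?_, ?_⟩
      · have := div_pos hpos (neg_pos.2 hneg)
        dsimp only
        split_ifs <;> linarith
      · simp [add_smul, Finset.sum_add_distrib]
    have := inOpenCone_iff.1 this j
    change 0 < g _ at this
    rw [map_add, map_smul, smul_eq_mul, div_mul_eq_mul_div, div_neg,
      mul_div_cancel_right₀ _ hneg.ne] at this
    simp at this
  have hv0 : ∀ k, v k ≠ 0 := fun k => hli.ne_zero k
  have hsub : coneVertices f P S ⊆
      Finset.univ.image fun k => Projectivization.mk ℝ (v k) (hv0 k) := by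
    intro p hp
    have hpK := vertexRep_mem hp
    set u := vertexRep f S p with hu
    obtain ⟨i, j, hij, hi, hj⟩ := (hP p).1 (Finset.mem_filter.1 hp).1
    obtain ⟨c, hc⟩ :=
      (Submodule.mem_span_range_iff_exists_fun ℝ).1 (hspan (Submodule.mem_top (x := u)))
    -- For `c k < 0`, adding `-(c k)⁻¹ • u` to `∑ v i` stays in the open cone but makes the `k`-th
    -- coordinate 0.
    have hcn : ∀ k, 0 ≤ c k := by
      intro k
      by_contra hneg
      push Not at hneg
      have hopen : InOpenCone f S (∑ i, v i + (-(c k)⁻¹) • u) := by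
        rw [inOpenCone_iff] at hx ⊢
        rw [inClosedCone_iff] at hpK
        intro m
        rw [map_add, map_smul, smul_eq_mul]
        have h1 := hx m
        have h2 := mul_nonneg (neg_nonneg.2 (inv_nonpos.2 hneg.le)) (hpK m)
        linarith
      obtain ⟨c', hc', he⟩ := (h _).1 hopen
      have := Fintype.linearIndependent_iff.1 hli
        (fun m => (1 + -(c k)⁻¹ * c m) - c' m)
        (by
          simp only [sub_smul, Finset.sum_sub_distrib, add_smul, Finset.sum_add_distrib, one_smul,
            mul_smul]
          rw [← he, ← Finset.smul_sum, hc, sub_self]) k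
      have h3 := hc' k
      have h4 : -(c k)⁻¹ * c k = -1 := by rw [neg_mul, inv_mul_cancel₀ hneg.ne]
      simp only [h4] at this
      linarith
    -- A form through `p` vanishes at every `v k` used by `u`. Applied to two lines through `p`,
    -- this puts such a `v k` on the line spanned by `p.rep`, so `p = [v k]`.
    have hzero : ∀ m, f m p.rep = 0 → ∀ k, c k ≠ 0 → f m (v k) = 0 := by
      intro m hm k hk
      have hmu : signedForm f S m u = 0 := by
        rw [signedForm_eq_zero_iff]
        rcases vertexRep_eq (f := f) (S := S) p with h | h
        · rw [hu, h, hm]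
        · rw [hu, h, map_neg, hm, neg_zero]
      rw [← hc, map_sum] at hmu
      simp only [map_smul, smul_eq_mul] at hmu
      have := (Finset.sum_eq_zero_iff_of_nonneg
        fun i _ => mul_nonneg (hcn i) (hvK i m)).1 hmu k (Finset.mem_univ _)
      exact signedForm_eq_zero_iff.1 ((mul_eq_zero.1 this).resolve_left hk)
    have hmem : ∀ k, c k ≠ 0 → v k ∈ Submodule.span ℝ {p.rep} := by
      intro k hk
      have h1 : v k ∈ LinearMap.ker (f i) ⊓ LinearMap.ker (f j) :=
        ⟨hzero i hi k hk, hzero j hj k hk⟩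
      obtain ⟨q, hq, -, -, hq'⟩ := hf.exists_point hij
      rw [hq' p hi hj, ← hq]
      exact h1
    obtain ⟨k, hk⟩ : ∃ k, c k ≠ 0 := by
      by_contra! h0
      apply vertexRep_ne_zero (f := f) (S := S) p
      rw [← hu, ← hc]
      simp [h0]
    refine Finset.mem_image.2 ⟨k, Finset.mem_univ _, ?_⟩
    obtain ⟨a, ha⟩ := Submodule.mem_span_singleton.1 (hmem k hk)
    conv_rhs => rw [← p.mk_rep]
    rw [Projectivization.mk_eq_mk_iff']
    exact ⟨a, ha⟩
  exact (Finset.card_le_card hsub).trans (Finset.card_image_le.trans (by simp))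

end Cones

/-! ### Positivity of the second log Chern number -/

section Positivity

variable {ι V : Type*} [AddCommGroup V] [Module ℝ V]
variable {f : ι → V →ₗ[ℝ] ℝ} {P : Finset (ℙ ℝ V)} {A B Z : Finset ι}

/-- If no point of the line `l` lies on two lines of `B ⊆ A`, then `l` meets the lines of `A` in
at least `|B|` points. -/
theorem card_le_card_pointsOn (hf : IsLineFamily f) (hP : IsMultiplePoints f P) {l : ι}
    (hl : l ∉ B) (hBA : B ⊆ A)
    (h : ∀ i ∈ B, ∀ j ∈ B, ∀ q : ℙ ℝ V, f l q.rep = 0 → f i q.rep = 0 → f j q.rep = 0 → i = j) :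
    B.card ≤ (pointsOn f P A l).card := by
  classical
  have hne : ∀ i ∈ B, l ≠ i := fun i hi h => hl (h ▸ hi)
  rcases B.eq_empty_or_nonempty with rfl | ⟨i₀, hi₀⟩
  · simp
  have : Nonempty (ℙ ℝ V) := ⟨(hf.exists_point (hne i₀ hi₀)).choose⟩
  choose! p hp using fun i (hi : i ∈ B) => hf.exists_point (hne i hi)
  refine Finset.card_le_card_of_injOn p (fun i hi => ?_) fun i hi j hj hij => ?_
  · obtain ⟨-, h1, h2, -⟩ := hp i hi
    exact Finset.mem_filter.2 ⟨(hP _).2 ⟨l, i, hne i hi, h1, h2⟩, h1, i, hBA hi, h2⟩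
  · obtain ⟨-, h1, h2, -⟩ := hp i hi
    obtain ⟨-, -, h3, -⟩ := hp j hj
    exact h i hi j hj (p i) h1 h2 (hij ▸ h3)

variable [DecidableEq ι]

/-- The pencil `Z` contributes `|Z| - 1` at `p`. Each further line misses `p`, so it meets the lines
of `Z` in `|Z|` distinct points. -/
theorem le_sum_multIn_sub_one (hf : IsLineFamily f) (hP : IsMultiplePoints f P) {p : ℙ ℝ V}
    (hp : p ∈ P) (hZ : ∀ i, i ∈ Z ↔ f i p.rep = 0) (B : Finset ι) (hB : Disjoint Z B) :
    Z.card - 1 + B.card * Z.card ≤ ∑ q ∈ P, (multIn f (Z ∪ B) q - 1) := by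
  classical
  induction B using Finset.induction_on with
  | empty =>
    rw [Finset.union_empty, Finset.card_empty, zero_mul, add_zero]
    refine le_trans ?_ (Finset.single_le_sum (fun _ _ => Nat.zero_le _) hp)
    rw [multIn, Finset.filter_true_of_mem fun i hi => (hZ i).1 hi]
  | insert l B hl ih =>
    rw [Finset.disjoint_insert_right] at hB
    have hlZ : f l p.rep ≠ 0 := fun h => hB.1 ((hZ l).2 h)
    have hlu : l ∉ Z ∪ B := by simp [hB.1, hl]
    rw [Finset.union_insert, sum_multIn_sub_one_insert hlu, Finset.card_insert_of_notMem hl]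
    have h1 := ih hB.2
    have h2 : Z.card ≤ (pointsOn f P (Z ∪ B) l).card := by
      refine card_le_card_pointsOn hf hP hB.1 Finset.subset_union_left fun i hi j hj q hq hqi hqj => ?_
      by_contra hij
      have := hf.eq_of_mem hij hqi hqj ((hZ i).1 hi) ((hZ j).1 hj)
      exact hlZ (this ▸ hq)
    linarith [add_mul B.card 1 Z.card]

theorem two_mul_le_sum_multIn_sub_one [Fintype ι] (hf : IsLineFamily f)
    (hP : IsMultiplePoints f P) (hd : 4 ≤ Fintype.card ι)
    (hmult : ∀ p ∈ P, multIn f Finset.univ p + 2 ≤ Fintype.card ι) :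
    2 * Fintype.card ι ≤ 2 + ∑ p ∈ P, (multIn f Finset.univ p - 1) := by
  classical
  have hZ : ∀ p : ℙ ℝ V, ∀ i, i ∈ (Finset.univ.filter fun i => f i p.rep = 0) ↔ f i p.rep = 0 := by
    simp
  by_cases h3 : ∃ p ∈ P, 3 ≤ multIn f Finset.univ p
  · obtain ⟨p, hp, hp3⟩ := h3
    have hp' := hmult p hp
    rw [multIn] at hp3 hp'
    have h := le_sum_multIn_sub_one hf hP hp (hZ p) _ disjoint_compl_right
    rw [Finset.union_compl, Finset.card_compl] at h
    generalize (Finset.univ.filter fun i => f i p.rep = 0).card = m at *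
    obtain ⟨k, hk⟩ := Nat.exists_eq_add_of_le hp'
    -- With multiplicity 3 + m and d = 5 + m + k, the bound is 8 + 3m + 3k + km, against the
    -- required 2d - 2 = 8 + 2m + 2k.
    obtain ⟨m, rfl⟩ := Nat.exists_eq_add_of_le hp3
    have hkm : Fintype.card ι - (3 + m) = k + 2 := by omega
    rw [hkm] at h
    have : 3 + m - 1 = m + 2 := by omega
    rw [this] at h
    rw [hk]
    nlinarith [Nat.zero_le (k * m)]
  -- Only double points: two lines give 1, the next d - 3 give at least 2 each, and the last line
  -- meets the others in d - 1 points. The total 3d - 6 is at least 2d - 2 because d ≥ 4.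
  · push Not at h3
    have hthree : ∀ i j l : ι, ∀ q : ℙ ℝ V, l ≠ i → l ≠ j → f l q.rep = 0 → f i q.rep = 0 →
        f j q.rep = 0 → i = j := by
      intro i j l q hli hlj hl hi hj
      by_contra hij
      have h := h3 q ((hP q).2 ⟨i, j, hij, hi, hj⟩)
      rw [multIn] at h
      have hsub : ({i, j, l} : Finset ι) ⊆ Finset.univ.filter fun i => f i q.rep = 0 := by
        intro x hx
        simp only [Finset.mem_insert, Finset.mem_singleton] at hx
        rcases hx with rfl | rfl | rfl <;> simpa
      have := Finset.card_le_card hsub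
      rw [Finset.card_eq_three.2 ⟨i, j, l, hij, hli.symm, hlj.symm, rfl⟩] at this
      omega
    obtain ⟨i, j, hij⟩ := Fintype.exists_pair_of_one_lt_card (by omega : 1 < Fintype.card ι)
    obtain ⟨p, -, hpi, hpj, -⟩ := hf.exists_point hij
    have hp : p ∈ P := (hP p).2 ⟨i, j, hij, hpi, hpj⟩
    set Z := Finset.univ.filter fun i => f i p.rep = 0 with hZdef
    have hZ2 : Z.card = 2 := by
      have h1 := h3 p hp
      have h2 : 1 < Z.card := Finset.one_lt_card.2 ⟨i, by simpa [Z], j, by simpa [Z], hij⟩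
      rw [multIn] at h1
      change Z.card < 3 at h1
      omega
    obtain ⟨l, hl⟩ : ∃ l, l ∈ Zᶜ := by
      apply Finset.card_pos.1
      rw [Finset.card_compl]
      omega
    have hlZ : l ∉ Z := Finset.mem_compl.1 hl
    have hdisj : Disjoint Z (Zᶜ.erase l) :=
      disjoint_compl_right.mono_right (Finset.erase_subset _ _)
    have h1 := le_sum_multIn_sub_one hf hP hp (hZ p) (Zᶜ.erase l) hdisj
    have hlu : l ∉ Z ∪ Zᶜ.erase l := by simp [hlZ]
    have huniv : insert l (Z ∪ Zᶜ.erase l) = Finset.univ := by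
      rw [← Finset.union_insert, Finset.insert_erase hl, Finset.union_compl]
    have h2 := sum_multIn_sub_one_insert (P := P) (f := f) hlu
    rw [huniv] at h2
    have h4 : (Z ∪ Zᶜ.erase l).card ≤ (pointsOn f P (Z ∪ Zᶜ.erase l) l).card := by
      refine card_le_card_pointsOn hf hP hlu subset_rfl fun i hi j hj q hq hqi hqj => ?_
      exact hthree i j l q (fun h => hlu (h ▸ hi)) (fun h => hlu (h ▸ hj)) hq hqi hqj
    have h5 : (Z ∪ Zᶜ.erase l).card + 1 = Fintype.card ι := by
      rw [← Finset.card_insert_of_notMem hlu, huniv, Finset.card_univ]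
    have h6 : Z.card + (Zᶜ.erase l).card = (Z ∪ Zᶜ.erase l).card :=
      (Finset.card_union_of_disjoint hdisj).symm
    rw [← hZdef, hZ2] at h1
    omega

end Positivity

/-! ### Melchior's inequality -/

section Melchior

variable {ι V : Type*} [AddCommGroup V] [Module ℝ V] [Fintype ι]
variable {f : ι → V →ₗ[ℝ] ℝ} {P : Finset (ℙ ℝ V)}

omit [Fintype ι] in
theorem IsLineFamily.exists_isMultiplePoints [Finite ι] (hf : IsLineFamily f) :
    ∃ P, IsMultiplePoints f P := by
  have hfin : {p : ℙ ℝ V | ∃ i j, i ≠ j ∧ f i p.rep = 0 ∧ f j p.rep = 0}.Finite := by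
    choose p _ _ _ hp using fun x : {x : ι × ι // x.1 ≠ x.2} => hf.exists_point x.2
    refine (Set.finite_range p).subset ?_
    rintro q ⟨i, j, hij, hi, hj⟩
    exact ⟨⟨(i, j), hij⟩, (hp ⟨(i, j), hij⟩ q hi hj).symm⟩
  exact ⟨hfin.toFinset, fun p => hfin.mem_toFinset⟩

theorem two_le_multIn (hP : IsMultiplePoints f P) {p : ℙ ℝ V} (hp : p ∈ P) :
    2 ≤ multIn f Finset.univ p := by
  classical
  obtain ⟨i, j, hij, hi, hj⟩ := (hP p).1 hp
  rw [multIn]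
  exact Finset.one_lt_card.2 ⟨i, by simpa, j, by simpa, hij⟩

theorem sum_multIn_sub_one_add_card (hP : IsMultiplePoints f P) :
    ∑ p ∈ P, (multIn f Finset.univ p - 1) + P.card = ∑ p ∈ P, multIn f Finset.univ p := by
  rw [Finset.card_eq_sum_ones, ← Finset.sum_add_distrib]
  refine Finset.sum_congr rfl fun p hp => ?_
  have := two_le_multIn hP hp
  omega

/-- Melchior's inequality, with the case of equality. -/
theorem three_add_sum_multIn_le [Nonempty ι] (hf : IsLineFamily f) (hP : IsMultiplePoints f P)
    (hrank : ∀ v, (∀ i, f i v = 0) → v = 0) (hfin : Module.finrank ℝ V = 3) :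
    3 + ∑ p ∈ P, multIn f Finset.univ p ≤ 3 * P.card ∧
      (3 + ∑ p ∈ P, multIn f Finset.univ p = 3 * P.card ↔
        ∀ S ∈ signRegions f ⊤ Finset.univ, (coneVertices f P S).card = 3) := by
  classical
  have hN := card_signRegions_top hf hP Finset.univ_nonempty
  have hE := sum_multIn_sub_one_add_card hP
  have hV := sum_card_coneVertices hf hP fun p => by
    by_contra! h
    exact p.rep_nonzero (hrank _ h)
  have h3 : ∀ S ∈ signRegions f ⊤ Finset.univ, 3 ≤ (coneVertices f P S).card := by
    intro S hS
    obtain ⟨x, hx⟩ := mem_signRegions_univ.1 hS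
    exact three_le_card_coneVertices hP hrank hfin hx
  have hle := Finset.sum_le_sum h3
  have heq := Finset.sum_eq_sum_iff_of_le h3
  -- Now `hle` reads 2(1 + f₁ - f₀) · 3 ≤ 4f₁, and `heq` is its equality case.
  rw [Finset.sum_const, smul_eq_mul, hV, hN] at hle heq
  refine ⟨by omega, ?_⟩
  rw [show (∀ S ∈ signRegions f ⊤ Finset.univ, (coneVertices f P S).card = 3) ↔
    ∀ S ∈ signRegions f ⊤ Finset.univ, 3 = (coneVertices f P S).card by simp only [eq_comm], ← heq]
  omega

end Melchior

/-! ### Components of the real complement -/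

section Components

variable {ι : Type*} {f : ι → (Fin 3 → ℝ) →ₗ[ℝ] ℝ} {S T : Finset ι}

theorem InOpenCone.smul {V : Type*} [AddCommGroup V] [Module ℝ V] {f : ι → V →ₗ[ℝ] ℝ} {v : V}
    (h : InOpenCone f S v) {b : ℝ} (hb : 0 < b) : InOpenCone f S (b • v) := by
  rw [inOpenCone_iff] at h ⊢
  intro i
  rw [map_smul]
  exact mul_pos hb (h i)

/-- The image of an open cone in the projective plane. -/
def coneImage (f : ι → (Fin 3 → ℝ) →ₗ[ℝ] ℝ) (S : Finset ι) : Set RP2 :=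
  {x | InOpenCone f S x.rep ∨ InOpenCone f S (-x.rep)}

theorem mk_mem_coneImage {v : Fin 3 → ℝ} (hv : v ≠ 0) :
    Projectivization.mk ℝ v hv ∈ coneImage f S ↔ InOpenCone f S v ∨ InOpenCone f S (-v) := by
  obtain ⟨a, ha⟩ := Projectivization.exists_smul_eq_mk_rep ℝ v hv
  rw [Units.smul_def] at ha
  have hs : ∀ {b : ℝ} {w : Fin 3 → ℝ}, b ≠ 0 → InOpenCone f S w ∨ InOpenCone f S (-w) →
      InOpenCone f S (b • w) ∨ InOpenCone f S (-(b • w)) := by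
    intro b w hb h
    rcases lt_or_gt_of_ne hb with hb | hb
    · have hb' := neg_pos.2 hb
      rcases h with h | h
      · right
        rw [← neg_smul]
        exact h.smul hb'
      · left
        rw [← neg_smul_neg]
        exact h.smul hb'
    · rcases h with h | h
      · exact Or.inl (h.smul hb)
      · right
        rw [← smul_neg]
        exact h.smul hb
  rw [coneImage, Set.mem_ofPred_eq, ← ha]
  refine ⟨fun h => ?_, fun h => hs a.ne_zero h⟩
  have := hs (inv_ne_zero a.ne_zero) h
  rwa [smul_smul, inv_mul_cancel₀ a.ne_zero, one_smul] at this

theorem isOpen_setOf_inOpenCone [Finite ι] : IsOpen {v : Fin 3 → ℝ | InOpenCone f S v} := by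
  simp only [inOpenCone_iff, Set.ofPred_forall]
  exact isOpen_iInter_of_finite fun i =>
    isOpen_lt continuous_const (signedForm f S i).continuous_of_finiteDimensional

theorem isOpen_coneImage [Finite ι] : IsOpen (coneImage f S) := by
  rw [isOpen_coinduced]
  have : Projectivization.mk' ℝ ⁻¹' coneImage f S =
      {v : {v : Fin 3 → ℝ // v ≠ 0} | InOpenCone f S v ∨ InOpenCone f S (-v.1)} := by
    ext v
    exact mk_mem_coneImage v.2
  rw [this, Set.ofPred_or]
  exact (isOpen_setOf_inOpenCone.preimage continuous_subtype_val).union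
    (isOpen_setOf_inOpenCone.preimage continuous_subtype_val.neg)

theorem InOpenCone.ne_zero [Nonempty ι] {V : Type*} [AddCommGroup V] [Module ℝ V]
    {f : ι → V →ₗ[ℝ] ℝ} {v : V} (h : InOpenCone f S v) : v ≠ 0 := by
  rintro rfl
  obtain ⟨i⟩ := ‹Nonempty ι›
  simpa using inOpenCone_iff.1 h i

theorem convex_setOf_inOpenCone : Convex ℝ {v : Fin 3 → ℝ | InOpenCone f S v} := by
  simp only [inOpenCone_iff, Set.ofPred_forall]
  exact convex_iInter fun i => convex_halfSpace_gt (signedForm f S i).isLinear 0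

theorem isPreconnected_coneImage [Nonempty ι] : IsPreconnected (coneImage f S) := by
  have himage : coneImage f S =
      Projectivization.mk' ℝ '' {v : {v : Fin 3 → ℝ // v ≠ 0} | InOpenCone f S v} := by
    ext x
    constructor
    · rintro (h | h)
      · exact ⟨⟨x.rep, x.rep_nonzero⟩, h, x.mk_rep⟩
      · refine ⟨⟨-x.rep, neg_ne_zero.2 x.rep_nonzero⟩, h, ?_⟩
        rw [Projectivization.mk'_eq_mk]
        conv_rhs => rw [← x.mk_rep]
        rw [Projectivization.mk_eq_mk_iff']
        exact ⟨-1, by simp⟩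
    · rintro ⟨v, hv, rfl⟩
      exact (mk_mem_coneImage v.2).2 (Or.inl hv)
  rw [himage]
  refine IsPreconnected.image ?_ _ continuous_coinduced_rng.continuousOn
  have : Subtype.val '' {v : {v : Fin 3 → ℝ // v ≠ 0} | InOpenCone f S v} =
      {v | InOpenCone f S v} := by
    ext v
    constructor
    · rintro ⟨w, hw, rfl⟩
      exact hw
    · exact fun h => ⟨⟨v, InOpenCone.ne_zero h⟩, h, rfl⟩
  have hpre : IsPreconnected {v | InOpenCone f S v} := convex_setOf_inOpenCone.isPreconnected
  rw [← this] at hpre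
  exact Topology.IsInducing.subtypeVal.isPreconnected_image.1 hpre

open Classical in
theorem exists_inOpenCone [Fintype ι] {V : Type*} [AddCommGroup V] [Module ℝ V]
    {f : ι → V →ₗ[ℝ] ℝ} {v : V} (h : ∀ i, f i v ≠ 0) : ∃ S, InOpenCone f S v := by
  refine ⟨Finset.univ.filter fun i => 0 < f i v, fun i hi => (Finset.mem_filter.1 hi).2,
    fun i hi => ?_⟩
  simp only [Finset.mem_filter, Finset.mem_univ, true_and, not_lt] at hi
  exact lt_of_le_of_ne hi (h i)

theorem InOpenCone.eq {V : Type*} [AddCommGroup V] [Module ℝ V]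
    {f : ι → V →ₗ[ℝ] ℝ} {v : V} (h : InOpenCone f S v) (h' : InOpenCone f T v) : S = T := by
  ext i
  constructor
  · intro hi
    by_contra hi'
    exact (h.1 i hi).not_gt (h'.2 i hi')
  · intro hi
    by_contra hi'
    exact (h'.1 i hi).not_gt (h.2 i hi')

theorem coneImage_subset : coneImage f S ⊆ {x : RP2 | ∀ i, f i x.rep ≠ 0} := by
  intro y hy i hi
  have hi' : f i (-y.rep) = 0 := by rw [map_neg, hi, neg_zero]
  rcases hy with hy | hy
  · exact (inOpenCone_iff.1 hy i).ne' (signedForm_eq_zero_iff.2 hi)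
  · exact (inOpenCone_iff.1 hy i).ne' (signedForm_eq_zero_iff.2 hi')

/-- The components of the complement of the lines are the images of the open cones. -/
theorem connectedComponentIn_eq_coneImage [Fintype ι] [Nonempty ι] {x : RP2}
    (hx : x ∈ coneImage f S) :
    connectedComponentIn {x : RP2 | ∀ i, f i x.rep ≠ 0} x = coneImage f S := by
  apply Set.Subset.antisymm
  -- The complement is covered by the open set `coneImage f S` and the union of the cone images
  -- disjoint from it.
  · refine isPreconnected_connectedComponentIn.subset_left_of_subset_union
      (v := ⋃ T ∈ {T | Disjoint (coneImage f S) (coneImage f T)}, coneImage f T) isOpen_coneImage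
      (isOpen_biUnion fun T _ => isOpen_coneImage) ?_ ?_ ⟨x, ?_, hx⟩
    · exact Set.disjoint_iUnion₂_right.2 fun T hT => hT
    · refine (connectedComponentIn_subset _ _).trans fun y hy => ?_
      by_cases hyS : y ∈ coneImage f S
      · exact Or.inl hyS
      · right
        obtain ⟨T, hT⟩ := exists_inOpenCone hy
        refine Set.mem_biUnion (x := T) ?_ (Or.inl hT)
        rw [Set.mem_ofPred_eq, Set.disjoint_left]
        intro z hzS hzT
        apply hyS
        -- Cone images that meet come from equal or antipodal cones. In the antipodal case `S` is
        -- the complement of `T`, which puts `-y.rep` in the cone of `S`.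
        have hneg : ∀ {v}, InOpenCone f T v → InOpenCone f S (-v) →
            InOpenCone f S (-y.rep) := by
          intro v h1 h2
          have h3 : ∀ i, i ∈ S ↔ i ∉ T := by
            intro i
            constructor
            · intro hi hi'
              have := h1.1 i hi'
              have := h2.1 i hi
              rw [map_neg] at this
              linarith
            · intro hi
              by_contra hi'
              have := h1.2 i hi
              have := h2.2 i hi'
              rw [map_neg] at this
              linarith
          refine ⟨fun i hi => ?_, fun i hi => ?_⟩
          · simpa using hT.2 i ((h3 i).1 hi)
          · rw [h3, not_not] at hi
            simpa using hT.1 i hi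
        rcases hzS with h1 | h1 <;> rcases hzT with h2 | h2
        · exact Or.inl (h1.eq h2 ▸ hT)
        · exact Or.inr (hneg h2 (by rwa [neg_neg]))
        · exact Or.inr (hneg h2 h1)
        · exact Or.inl (h1.eq h2 ▸ hT)
    · exact mem_connectedComponentIn (coneImage_subset hx)
  · exact isPreconnected_coneImage.subset_connectedComponentIn hx coneImage_subset

/-- A projective triangle fixes its vectors only up to sign, so the work is to show that, after
replacing `v` by `-v` if necessary, all positive combinations lie in the same one of the two
antipodal cones. -/
theorem isOpenTriangle_coneImage_iff [Nonempty ι] :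
    IsOpenTriangle (coneImage f S) ↔ ∃ v : Fin 3 → Fin 3 → ℝ, LinearIndependent ℝ v ∧
      ∀ y, InOpenCone f S y ↔ ∃ c : Fin 3 → ℝ, (∀ i, 0 < c i) ∧ y = ∑ i, c i • v i := by
  obtain ⟨i₀⟩ := ‹Nonempty ι›
  have : Nonempty ι := ⟨i₀⟩
  constructor
  · rintro ⟨v, hli, hv⟩
    have hne : ∀ c : Fin 3 → ℝ, (∀ i, 0 < c i) → ∑ i, c i • v i ≠ 0 := fun c hc h =>
      (hc 0).ne' (Fintype.linearIndependent_iff.1 hli c h 0)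
    have hT : ∀ c : Fin 3 → ℝ, (∀ i, 0 < c i) →
        InOpenCone f S (∑ i, c i • v i) ∨ InOpenCone f S (-∑ i, c i • v i) := by
      intro c hc
      rw [← mk_mem_coneImage (hne c hc), hv]
      refine ⟨c, hc, ?_⟩
      rw [Projectivization.submodule_mk]
      exact Submodule.mem_span_singleton_self _
    have hC : ∀ w, InOpenCone f S w → ∃ c : Fin 3 → ℝ, (∀ i, 0 < c i) ∧
        ∃ b : ℝ, b • w = ∑ i, c i • v i := by
      intro w hw
      have : Projectivization.mk ℝ w hw.ne_zero ∈ coneImage f S :=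
        (mk_mem_coneImage hw.ne_zero).2 (Or.inl hw)
      rw [hv] at this
      obtain ⟨c, hc, h⟩ := this
      rw [Projectivization.submodule_mk] at h
      exact ⟨c, hc, Submodule.mem_span_singleton.1 h⟩
    clear hv
    wlog h1 : InOpenCone f S (∑ i, v i) generalizing v
    · have h2 : InOpenCone f S (-∑ i, v i) := by
        have := hT 1 fun _ => one_pos
        simp only [Pi.one_apply, one_smul] at this
        exact this.resolve_left h1
      have hsum : ∀ c : Fin 3 → ℝ, ∑ i, c i • (-v) i = -∑ i, c i • v i := by simp
      refine this (-v) ?_ ?_ ?_ ?_ ?_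
      · simpa using hli.units_smul fun _ => (-1 : ℝˣ)
      · intro c hc
        rw [hsum]
        exact neg_ne_zero.2 (hne c hc)
      · intro c hc
        rw [hsum, neg_neg]
        exact (hT c hc).symm
      · intro w hw
        obtain ⟨c, hc, b, h⟩ := hC w hw
        exact ⟨c, hc, -b, by rw [hsum, ← h, neg_smul]⟩
      · simpa using h2
    have hpos : ∀ c : Fin 3 → ℝ, (∀ i, 0 < c i) → InOpenCone f S (∑ i, c i • v i) := by
      intro c hc
      refine (hT c hc).resolve_right fun hneg => ?_
      have ha := inOpenCone_iff.1 h1 i₀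
      have hb := inOpenCone_iff.1 hneg i₀
      set g := signedForm f S i₀ with hg
      set a := g (∑ i, v i)
      set b := g (-∑ i, c i • v i) with hbdef
      -- If `∑ v i` and `∑ c i • v i` lay in opposite cones, this positive combination would be a
      -- zero of `g`, yet it must lie in one of the cones.
      have hu : ∑ i, (b + a * c i) • v i = b • ∑ i, v i + a • ∑ i, c i • v i := by
        simp [add_smul, Finset.sum_add_distrib, Finset.smul_sum, mul_smul]
      have hgu : g (∑ i, (b + a * c i) • v i) = 0 := by
        rw [hu, map_add, map_smul, map_smul, hbdef, map_neg]
        simp only [smul_eq_mul]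
        ring
      rcases hT (fun i => b + a * c i) (fun i => add_pos hb (mul_pos ha (hc i))) with h | h
      · exact (inOpenCone_iff.1 h i₀).ne' hgu
      · refine (inOpenCone_iff.1 h i₀).ne' ?_
        rw [map_neg, ← hg, hgu, neg_zero]
    refine ⟨v, hli, fun y => ⟨fun hy => ?_, ?_⟩⟩
    · obtain ⟨c, hc, b, h⟩ := hC y hy
      have hb : 0 < b := by
        have h2 := inOpenCone_iff.1 (hpos c hc) i₀
        rw [← h, map_smul, smul_eq_mul] at h2
        exact (pos_iff_pos_of_mul_pos h2).2 (inOpenCone_iff.1 hy i₀)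
      refine ⟨fun i => b⁻¹ * c i, fun i => mul_pos (inv_pos.2 hb) (hc i), ?_⟩
      simp only [mul_smul, ← Finset.smul_sum]
      rw [← h, smul_smul, inv_mul_cancel₀ hb.ne', one_smul]
    · rintro ⟨c, hc, rfl⟩
      exact hpos c hc
  · rintro ⟨v, hli, hv⟩
    refine ⟨v, hli, ?_⟩
    ext y
    rw [Set.mem_ofPred_eq, Projectivization.submodule_eq]
    constructor
    · rintro (h | h)
      · obtain ⟨c, hc, hy⟩ := (hv _).1 h
        exact ⟨c, hc, hy ▸ Submodule.mem_span_singleton_self _⟩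
      · obtain ⟨c, hc, hy⟩ := (hv _).1 h
        exact ⟨c, hc, hy ▸ Submodule.neg_mem _ (Submodule.mem_span_singleton_self _)⟩
    · rintro ⟨c, hc, h⟩
      obtain ⟨b, hb⟩ := Submodule.mem_span_singleton.1 h
      have hopen := (hv _).2 ⟨c, hc, hb⟩
      have hb0 : b ≠ 0 := by
        rintro rfl
        exact hopen.ne_zero (zero_smul _ _)
      have := (mk_mem_coneImage (f := f) hopen.ne_zero).2 (Or.inl hopen)
      convert this using 1
      conv_lhs => rw [← y.mk_rep]
      rw [Projectivization.mk_eq_mk_iff']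
      exact ⟨b⁻¹, by rw [smul_smul, inv_mul_cancel₀ hb0, one_smul]⟩

end Components

/-! ### Coefficient vectors, cross products and real points of complex lines -/

section Forms

open Matrix

/-- The linear form on `ℝ³` with coefficients `a`. -/
noncomputable def coeffForm (a : Fin 3 → ℝ) : (Fin 3 → ℝ) →ₗ[ℝ] ℝ :=
  ∑ i, a i • LinearMap.proj i

theorem coeffForm_apply (a v : Fin 3 → ℝ) : coeffForm a v = a ⬝ᵥ v := by
  simp [coeffForm, dotProduct]

/-- By the triple product expansion, `(a ⨯₃ b) ⨯₃ x = 0`, so `x` is parallel to `a ⨯₃ b`. Any field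
is allowed because both ℝ and ℂ are needed. -/
theorem exists_smul_cross_eq {K : Type*} [Field K] {a b x : Fin 3 → K} (hab : a ⨯₃ b ≠ 0)
    (ha : a ⬝ᵥ x = 0) (hb : b ⬝ᵥ x = 0) : ∃ c : K, c • (a ⨯₃ b) = x := by
  have h : (a ⨯₃ b) ⨯₃ x = 0 := by
    rw [cross_cross_eq_smul_sub_smul, ha, hb, zero_smul, zero_smul, sub_zero]
  by_contra! hne
  exact crossProduct_ne_zero_iff_linearIndependent.2
    ((LinearIndependent.pair_iff' hab).2 hne) h

theorem isLineFamily_coeffForm {ι : Type*} {a : ι → Fin 3 → ℝ} (ha : ∀ i, a i ≠ 0)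
    (h : ∀ i j, i ≠ j → a i ⨯₃ a j ≠ 0) : IsLineFamily fun i => coeffForm (a i) where
  exists_ne i := ⟨a i, by rw [coeffForm_apply]; simpa using ha i⟩
  exists_ne_of_ne i j hij := by
    -- Orthogonal to `a i`; its product with `a j` is minus the squared length of `a i ⨯₃ a j`,
    -- nonzero over ℝ.
    refine ⟨a i ⨯₃ (a i ⨯₃ a j), by rw [coeffForm_apply, dot_self_cross], ?_⟩
    rw [coeffForm_apply, triple_product_permutation, triple_product_permutation, ← cross_anticomm,
      neg_dotProduct, neg_ne_zero]
    simpa using h j i hij.symm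
  inter i j hij := by
    refine ⟨a i ⨯₃ a j, h i j hij, le_antisymm ?_ ?_⟩
    · rintro x ⟨hi, hj⟩
      rw [SetLike.mem_coe, LinearMap.mem_ker, coeffForm_apply] at hi hj
      exact Submodule.mem_span_singleton.2 (exists_smul_cross_eq (h i j hij) hi hj)
    · rw [Submodule.span_singleton_le_iff_mem]
      exact ⟨by rw [SetLike.mem_coe, LinearMap.mem_ker, coeffForm_apply, dot_self_cross],
        by rw [SetLike.mem_coe, LinearMap.mem_ker, coeffForm_apply, dot_cross_self]⟩

theorem mem_zeroLocus_iff {a : Fin 3 → ℂ} {p : CP2} : p ∈ zeroLocus a ↔ a ⬝ᵥ p.rep = 0 := by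
  change (∀ v ∈ p.submodule, a ⬝ᵥ v = 0) ↔ _
  rw [Projectivization.submodule_eq]
  constructor
  · exact fun h => h _ (Submodule.mem_span_singleton_self _)
  · rintro h v hv
    obtain ⟨c, rfl⟩ := Submodule.mem_span_singleton.1 hv
    rw [dotProduct_smul, h, smul_zero]

theorem mk_mem_zeroLocus_iff {a v : Fin 3 → ℂ} {hv : v ≠ 0} :
    Projectivization.mk ℂ v hv ∈ zeroLocus a ↔ a ⬝ᵥ v = 0 := by
  obtain ⟨c, hc⟩ := Projectivization.exists_smul_eq_mk_rep ℂ v hv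
  rw [mem_zeroLocus_iff, ← hc, Units.smul_def, dotProduct_smul, smul_eq_mul, mul_eq_zero,
    or_iff_right c.ne_zero]

theorem complexify_dotProduct (a v : Fin 3 → ℝ) :
    complexify a ⬝ᵥ complexify v = ((a ⬝ᵥ v : ℝ) : ℂ) := by
  simp [dotProduct, complexify]

theorem complexify_cross (a b : Fin 3 → ℝ) :
    complexify a ⨯₃ complexify b = complexify (a ⨯₃ b) := by
  ext i
  fin_cases i <;> simp [cross_apply, complexify]

theorem complexify_ne_zero {v : Fin 3 → ℝ} (hv : v ≠ 0) : complexify v ≠ 0 :=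
  (map_ne_zero_iff complexify complexify_injective).2 hv

theorem toCP2_mem_zeroLocus_iff {a : Fin 3 → ℝ} {x : RP2} :
    x.toCP2 ∈ zeroLocus (complexify a) ↔ coeffForm a x.rep = 0 := by
  have : x.toCP2 = Projectivization.mk ℂ (complexify x.rep) (complexify_ne_zero x.rep_nonzero) := by
    conv_lhs => rw [← x.mk_rep]
    rw [RP2.toCP2, Projectivization.map_mk]
  rw [this, mk_mem_zeroLocus_iff, complexify_dotProduct, coeffForm_apply, Complex.ofReal_eq_zero]

/-- The intersection of two distinct real lines of the complex plane is a real point. -/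
theorem exists_toCP2_eq {a b : Fin 3 → ℝ} (hab : a ⨯₃ b ≠ 0) {p : CP2}
    (ha : p ∈ zeroLocus (complexify a)) (hb : p ∈ zeroLocus (complexify b)) :
    ∃ x : RP2, x.toCP2 = p := by
  rw [mem_zeroLocus_iff] at ha hb
  have hc : complexify a ⨯₃ complexify b ≠ 0 := by
    rw [complexify_cross]
    exact complexify_ne_zero hab
  obtain ⟨c, hcp⟩ := exists_smul_cross_eq hc ha hb
  refine ⟨Projectivization.mk ℝ _ hab, ?_⟩
  rw [RP2.toCP2, Projectivization.map_mk]
  conv_rhs => rw [← p.mk_rep]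
  rw [eq_comm, Projectivization.mk_eq_mk_iff']
  exact ⟨c, by rw [← hcp, complexify_cross]⟩

theorem cross_ne_zero_of_zeroLocus_ne {a b : Fin 3 → ℝ} (ha : a ≠ 0) (hb : b ≠ 0)
    (h : zeroLocus (complexify a) ≠ zeroLocus (complexify b)) : a ⨯₃ b ≠ 0 := by
  rw [crossProduct_ne_zero_iff_linearIndependent, LinearIndependent.pair_iff' ha]
  rintro c rfl
  apply h
  have hc : c ≠ 0 := by
    rintro rfl
    exact hb (zero_smul _ _)
  ext p
  rw [mem_zeroLocus_iff, mem_zeroLocus_iff, map_smulₛₗ, smul_dotProduct, smul_eq_mul, mul_eq_zero,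
    or_iff_right (by simpa using hc)]

end Forms

/-! ### Translation to the complex arrangement and the main theorem -/

namespace RealLineArrangement

variable (L : RealLineArrangement)

/-- Real linear forms defining the lines of the arrangement. -/
noncomputable def forms (l : L.lines) : (Fin 3 → ℝ) →ₗ[ℝ] ℝ :=
  coeffForm (L.isRealLine l l.2).choose

theorem isLineFamily_forms : IsLineFamily L.forms := by
  refine isLineFamily_coeffForm (fun l => (L.isRealLine l l.2).choose_spec.1) fun l m hlm => ?_
  refine cross_ne_zero_of_zeroLocus_ne (L.isRealLine l l.2).choose_spec.1
    (L.isRealLine m m.2).choose_spec.1 ?_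
  rw [← (L.isRealLine l l.2).choose_spec.2, ← (L.isRealLine m m.2).choose_spec.2]
  exact fun h => hlm (Subtype.ext h)

theorem toCP2_mem_iff (l : L.lines) (x : RP2) : x.toCP2 ∈ l.1 ↔ L.forms l x.rep = 0 := by
  rw [forms, ← toCP2_mem_zeroLocus_iff, ← (L.isRealLine l l.2).choose_spec.2]

theorem mult_toCP2 (x : RP2) : L.mult x.toCP2 = multIn L.forms Finset.univ x := by
  classical
  have : {l | l ∈ L.lines ∧ x.toCP2 ∈ l} =
      ((Finset.univ.filter fun l => L.forms l x.rep = 0).map (Function.Embedding.subtype _) :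
        Finset (Set CP2)) := by
    ext l
    simp only [Set.mem_ofPred_eq, Finset.coe_map, Set.mem_image, Finset.mem_coe,
      Finset.mem_filter, Finset.mem_univ, true_and, ← toCP2_mem_iff]
    constructor
    · exact fun h => ⟨⟨l, h.1⟩, h.2, rfl⟩
    · rintro ⟨m, hm, rfl⟩
      exact ⟨m.2, hm⟩
  rw [mult, this, Set.ncard_coe_finset, Finset.card_map, multIn]

theorem exists_toCP2_eq_of_two_le_mult {p : CP2} (hp : 2 ≤ L.mult p) :
    ∃ x : RP2, x.toCP2 = p := by
  obtain ⟨l, hl, m, hm, hlm⟩ :=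
    (Set.one_lt_ncard (L.lines.finite_toSet.subset fun _ h => h.1)).1 hp
  obtain ⟨a, ha, rfl⟩ := L.isRealLine l hl.1
  obtain ⟨b, hb, rfl⟩ := L.isRealLine m hm.1
  exact exists_toCP2_eq (cross_ne_zero_of_zeroLocus_ne ha hb hlm) hl.2 hm.2

variable {L} {P : Finset RP2}

theorem toCP2_injOn (hP : IsMultiplePoints L.forms P) :
    Set.InjOn RP2.toCP2 (P : Set RP2) := by
  intro x hx y _ hxy
  obtain ⟨l, m, hlm, hl, hm⟩ := (hP x).1 hx
  refine L.isLineFamily_forms.eq_of_mem hlm hl hm ?_ ?_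
  · rwa [← toCP2_mem_iff, ← hxy, toCP2_mem_iff]
  · rwa [← toCP2_mem_iff, ← hxy, toCP2_mem_iff]

theorem mem_of_two_le (hP : IsMultiplePoints L.forms P) {x : RP2}
    (hx : 2 ≤ multIn L.forms Finset.univ x) : x ∈ P := by
  classical
  rw [multIn] at hx
  obtain ⟨l, hl, m, hm, hlm⟩ := Finset.one_lt_card.1 hx
  exact (hP x).2 ⟨l, m, hlm, (Finset.mem_filter.1 hl).2, (Finset.mem_filter.1 hm).2⟩

-- The bound `2 ≤ r` makes the complex points real, as intersections of two distinct real lines.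
open Classical in
theorem t_eq (hP : IsMultiplePoints L.forms P) {r : ℕ} (hr : 2 ≤ r) :
    L.t r = (P.filter fun x => multIn L.forms Finset.univ x = r).card := by
  have : {p : CP2 | L.mult p = r} =
      RP2.toCP2 '' (P.filter fun x => multIn L.forms Finset.univ x = r : Finset RP2) := by
    ext p
    simp only [Set.mem_ofPred_eq, Set.mem_image, Finset.mem_coe, Finset.mem_filter]
    constructor
    · rintro rfl
      obtain ⟨x, rfl⟩ := L.exists_toCP2_eq_of_two_le_mult hr
      rw [mult_toCP2] at hr ⊢
      exact ⟨x, ⟨mem_of_two_le hP hr, rfl⟩, rfl⟩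
    · rintro ⟨x, ⟨-, rfl⟩, rfl⟩
      exact mult_toCP2 L x
  rw [t, this, Set.InjOn.ncard_image, Set.ncard_coe_finset]
  exact (toCP2_injOn hP).mono (Finset.coe_subset.2 (Finset.filter_subset _ _))

theorem multIn_le_d (x : RP2) : multIn L.forms Finset.univ x ≤ L.d := by
  classical
  rw [multIn]
  refine (Finset.card_filter_le _ _).trans_eq ?_
  rw [Finset.card_univ, Fintype.card_coe, d]

theorem multIn_mem_Icc (hP : IsMultiplePoints L.forms P) :
    ∀ x ∈ P, multIn L.forms Finset.univ x ∈ Finset.Icc 2 L.d :=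
  fun x hx => Finset.mem_Icc.2 ⟨two_le_multIn hP hx, multIn_le_d x⟩

theorem f₀_eq (hP : IsMultiplePoints L.forms P) : L.f₀ = P.card := by
  classical
  rw [f₀, Finset.card_eq_sum_card_fiberwise (multIn_mem_Icc hP)]
  exact Finset.sum_congr rfl fun r hr => t_eq hP (Finset.mem_Icc.1 hr).1

theorem f₁_eq (hP : IsMultiplePoints L.forms P) :
    L.f₁ = ∑ x ∈ P, multIn L.forms Finset.univ x := by
  classical
  rw [f₁, ← Finset.sum_fiberwise_of_maps_to (multIn_mem_Icc hP)]
  refine Finset.sum_congr rfl fun r hr => ?_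
  rw [t_eq hP (Finset.mem_Icc.1 hr).1, Finset.sum_congr rfl fun x hx => (Finset.mem_filter.1 hx).2,
    Finset.sum_const, smul_eq_mul, mul_comm]

theorem multIn_ne_of_t_eq_zero (hP : IsMultiplePoints L.forms P) {r : ℕ} (hr : 2 ≤ r)
    (ht : L.t r = 0) (x : RP2) : multIn L.forms Finset.univ x ≠ r := by
  classical
  rintro rfl
  rw [t_eq hP hr, Finset.card_eq_zero] at ht
  exact Finset.notMem_empty x (ht ▸ Finset.mem_filter.2 ⟨mem_of_two_le hP hr, rfl⟩)

/-- The components are the images of the open cones, and such an image is a triangle exactly when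
its cone has three vertices. -/
theorem isSimplicial_iff (hP : IsMultiplePoints L.forms P) (hne : L.lines.Nonempty)
    (hrank : ∀ v, (∀ l, L.forms l v = 0) → v = 0) :
    L.IsSimplicial ↔
      ∀ S ∈ signRegions L.forms ⊤ Finset.univ, (coneVertices L.forms P S).card = 3 := by
  have : Nonempty L.lines := hne.coe_sort
  have hfin : Module.finrank ℝ (Fin 3 → ℝ) = 3 := by simp
  have hcompl : L.realComplement = {x : RP2 | ∀ l, L.forms l x.rep ≠ 0} := by
    ext x
    simp only [realComplement, Set.mem_ofPred_eq, ne_eq, ← toCP2_mem_iff, Subtype.forall]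
  have key : ∀ {S : Finset L.lines} {v : Fin 3 → ℝ}, InOpenCone L.forms S v →
      (IsOpenTriangle (coneImage L.forms S) ↔ (coneVertices L.forms P S).card = 3) := by
    intro S v hv
    rw [isOpenTriangle_coneImage_iff]
    constructor
    · rintro ⟨b, hli, h⟩
      exact le_antisymm (card_coneVertices_le_three L.isLineFamily_forms hP hfin hli h)
        (three_le_card_coneVertices hP hrank hfin hv)
    · exact exists_simplicial_of_card_eq_three hP L.isLineFamily_forms.exists_ne hrank hfin hv
  rw [IsSimplicial, hcompl]
  constructor
  · intro h S hS
    obtain ⟨v, hv⟩ := mem_signRegions_univ.1 hS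
    have hmem := (mk_mem_coneImage hv.ne_zero).2 (Or.inl hv)
    rw [← key hv, ← connectedComponentIn_eq_coneImage hmem]
    exact h _ (coneImage_subset hmem)
  · intro h x hx
    obtain ⟨S, hS⟩ := exists_inOpenCone hx
    rw [connectedComponentIn_eq_coneImage (Or.inl hS), key hS]
    exact h S (mem_signRegions_univ.2 ⟨_, hS⟩)

end RealLineArrangement

theorem mainTheorem9 (L : RealLineArrangement) (hd : 4 ≤ L.d)
    (ht : L.t L.d = 0) (ht' : L.t (L.d - 1) = 0) :
    0 < L.logChernTwo ∧
      L.charNumber ≤ 5 / 2 ∧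
      (L.charNumber = 5 / 2 ↔ L.IsSimplicial) := by
  classical
  obtain ⟨P, hP⟩ := L.isLineFamily_forms.exists_isMultiplePoints
  have hne : L.lines.Nonempty := Finset.card_pos.1 (by change 0 < L.d; omega)
  have : Nonempty L.lines := hne.coe_sort
  have hmult : ∀ x ∈ P, multIn L.forms Finset.univ x + 2 ≤ Fintype.card L.lines := by
    intro x _
    have h1 := RealLineArrangement.multIn_le_d (L := L) x
    have h2 := RealLineArrangement.multIn_ne_of_t_eq_zero hP (by omega) ht x
    have h3 := RealLineArrangement.multIn_ne_of_t_eq_zero hP (by omega) ht' x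
    rw [Fintype.card_coe]
    change _ ≤ L.d
    omega
  have hrank : ∀ v, (∀ l, L.forms l v = 0) → v = 0 := by
    intro v hv
    by_contra hv0
    -- A common zero of all the forms would be a point of multiplicity d.
    refine RealLineArrangement.multIn_ne_of_t_eq_zero hP (by omega) ht
      (Projectivization.mk ℝ v hv0) ?_
    obtain ⟨a, ha⟩ := Projectivization.exists_smul_eq_mk_rep ℝ v hv0
    rw [multIn, Finset.filter_true_of_mem, Finset.card_univ, Fintype.card_coe]
    · rfl
    · intro l _
      rw [← ha, Units.smul_def, map_smul, hv, smul_zero]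
  have hpos := two_mul_le_sum_multIn_sub_one L.isLineFamily_forms hP
    (by rw [Fintype.card_coe]; exact hd) hmult
  have hsum := sum_multIn_sub_one_add_card hP
  obtain ⟨hle, heq⟩ := three_add_sum_multIn_le L.isLineFamily_forms hP hrank (by simp)
  rw [← RealLineArrangement.isSimplicial_iff hP hne hrank] at heq
  rw [← RealLineArrangement.f₁_eq hP, ← RealLineArrangement.f₀_eq hP] at hle heq hsum
  rw [Fintype.card_coe] at hpos
  change 2 * L.d ≤ _ at hpos
  have hc2 : 0 < L.logChernTwo := by
    rw [RealLineArrangement.logChernTwo]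
    omega
  have hc2' : (0 : ℝ) < L.logChernTwo := by exact_mod_cast hc2
  -- This turns the comparison of γ with 5/2 into Melchior's inequality.
  have hc1 : 2 * L.logChernOneSq = 5 * L.logChernTwo + (3 + L.f₁ - 3 * L.f₀) := by
    rw [RealLineArrangement.logChernOneSq, RealLineArrangement.logChernTwo]
    ring
  have hc1' : (2 : ℝ) * L.logChernOneSq = 5 * L.logChernTwo + (3 + L.f₁ - 3 * L.f₀) := by
    exact_mod_cast hc1
  have hle' : (3 : ℝ) + L.f₁ ≤ 3 * L.f₀ := by exact_mod_cast hle
  refine ⟨hc2, ?_, ?_⟩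
  · rw [RealLineArrangement.charNumber, div_le_iff₀ hc2']
    linarith
  · rw [← heq, RealLineArrangement.charNumber, div_eq_iff hc2'.ne']
    rw [← Nat.cast_inj (R := ℝ)]
    push_cast
    constructor <;> intro h <;> linarith
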